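/- **Setting.** $\log$ is the logarithm to base $2$, $\Delta_d$ the probability simplex in $\mathbb{R}^d$, $a\vee b=\max\{a,b\}$, $H(p)=-\sum_i p_i\log p_i$. Let $N\ge 2$, let $W\in\mathbb{R}^{N\times M}$ be the transition matrix of a discrete memoryless channel with input alphabet $\{1,\dots,N\}$ and output alphabet $\{1,\dots,M\}$ (rows sum to $1$), and let $\gamma>0$ satisfy $W_{ij}\ge\gamma$ for all $i,j$ (e.g. $\gamma=\min_{i,j}W_{ij}$). Put $r_i=-\sum_j W_{ij}\log W_{ij}$ and $I(p,W)=\sum_{i,j}p_iW_{ij}\log\frac{W_{ij}}{(W^\top p)_j}$. Let $P$ be either $\Delta_N$ (no cost constraint) or a nonempty set $\{p\in\Delta_N: s^\top p=S\}$ with $s\in\mathbb{R}^N$, $S\in\mathbb{R}$. For a cost vector $s$ and budget $S$ let $C_S(W)=\max\{I(p,W):p\in\Delta_N,\ s^\top p\le S\}$, and let $S_{\max}$ be the minimum of $s^\top p$ over all maximizers $p$ of $I(\cdot,W)$ on $\Delta_N$. We say that $P$ *represents* the problem $C_S(W)$ if either $S<S_{\max}$ and $P=\{p\in\Delta_N:s^\top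 p=S\}$, or $S\ge S_{\max}$ and $P=\Delta_N$. (The case $s=0$, $S=0$, $P=\Delta_N$ is the unconstrained capacity.) For $\lambda\in\mathbb{R}^M$ and $\nu>0$ let $$F(\lambda)=\max_{q\in\Delta_M}\{H(q)-\lambda^\top q\},\qquad G(\lambda)=\max_{p\in P}\{-r^\top p+\lambda^\top W^\top p\},$$ $$G_\nu(\lambda)=\max_{p\in P}\{-r^\top p+\lambda^\top W^\top p+\nu H(p)-\nu\log N\},$$ and let $p_\nu(\lambda)$ be the unique maximizer in $G_\nu(\lambda)$. The dual problem is to minimize $F+G$ over $\mathbb{R}^M$. Let $R=M\left(\log(1/\gamma)\vee\frac1{\ln 2}\right)$, $Q=\{\lambda\in\mathbb{R}^M:\|\lambda\|_2\le R\}$, $\pi_Q$ the Euclidean projection onto $Q$, $$D_1=\tfrac12\left(\left(M\log\tfrac1\gamma\right)\vee\tfrac1{\ln2}\right)^2,\qquad D_2=\log N.$$ **Algorithm.** Given $n\in\{0,1,2,\dots\}$, set $\nu=\frac{2}{n+1}\sqrt{D_1/D_2}$ and $L_\nu=1+\frac1\nu$. Start from any $x_0\in Q$, and for $k=0,1,\dots,n$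 put $g_k=\nabla F(x_k)+\nabla G_\nu(x_k)$, $$y_k=\pi_Q\left(x_k-\tfrac1{L_\nu}g_k\right),\quad z_k=\pi_Q\left(-\tfrac1{L_\nu}\sum_{i=0}^k\tfrac{i+1}2 g_i\right),\quad x_{k+1}=\tfrac2{k+3}z_k+\tfrac{k+1}{k+3}y_k .$$ The output is $\hat\lambda=y_n$ and $\hat p=\sum_{k=0}^n\frac{2(k+1)}{(n+1)(n+2)}\,p_\nu(x_k)$. **Theorem.** 1. For all $n$ and all $x_0\in Q$: $\hat\lambda\in Q$, $\hat p\in P\subseteq\Delta_N$, and $$0\le F(\hat\lambda)+G(\hat\lambda)-I(\hat p,W)\le\frac{4}{n+1}\sqrt{D_1D_2}+\frac{4D_1}{(n+1)^2}.$$ 2. For every $\varepsilon>0$ there is an integer $n_0\ge 0$ with $n_0\le 4\sqrt{D_1D_2}\,\frac1\varepsilon+2\sqrt{\frac{D_1}{\varepsilon}}$ such that for all $n\ge n_0$ and all $x_0\in Q$ the output is an $\varepsilon$-solution: $\hat p\in P$, $F(\hat\lambda)+G(\hat\lambda)-I(\hat p,W)\le\varepsilon$, $F(\hat\lambda)+G(\hat\lambda)\le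 F(\lambda)+G(\lambda)+\varepsilon$ for all $\lambda\in\mathbb{R}^M$, $I(p,W)\le I(\hat p,W)+\varepsilon$ for all $p\in P$, and, for every capacity problem $C_S(W)$ that $P$ represents, $I(\hat p,W)\le C_S(W)\le F(\hat\lambda)+G(\hat\lambda)$, where both outer terms differ from $C_S(W)$ by at most $\varepsilon$. 3. Count as one operation each natural-number constant, $+,-,\cdot,/$, $\max$, $\sqrt{\cdot}$, $\exp$ and $\ln$ of real numbers. There is an absolute constant $C$ such that, for all $N\ge2$, $M\ge1$ and without cost constraint ($P=\Delta_N$): for each $n$ the output $(\hat\lambda,\hat p)$ is computed from $(W,x_0,\gamma)$ by a straight-line program, depending only on $N,M,n$, with at most $C\,MN(n+1)$ operations; and for all $\gamma>0$ and $0<\varepsilon\le1$ there is an $n\le 4\sqrt{D_1D_2}\,\frac1\varepsilon+2\sqrt{D_1/\varepsilon}$ for which such a program has at most $$C\left(\log\tfrac1\gamma\vee\tfrac1{\ln2}\right)\frac{M^2N\sqrt{\log N}}{\varepsilon}$$ operations and its output is an $\varepsilon$-solution for every channel $W$ with $W_{ij}\ge\gamma$ for all $i,j$ and every $x_0\in Q$.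 -/

import Mathlib

namespace DMC

noncomputable section

variable {N M : ℕ}

/-! ### Channels, entropy, mutual information (logarithms to base 2) -/

/-- `W i j` is the probability of output `j` given input `i`. -/
structure IsChannel (W : Matrix (Fin N) (Fin M) ℝ) : Prop where
  nonneg : ∀ i j, 0 ≤ W i j
  row_sum : ∀ i, ∑ j, W i j = 1

/-- Entropy in bits. -/
def entropy {d : ℕ} (p : Fin d → ℝ) : ℝ := ∑ i, -(p i * Real.logb 2 (p i))

/-- The output distribution `Wᵀ p`. -/
def output (W : Matrix (Fin N) (Fin M) ℝ) (p : Fin N → ℝ) (j : Fin M) : ℝ := ∑ i, W i j * p i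

/-- `r i`, the entropy of the output given the input `i`. -/
def condEntropy (W : Matrix (Fin N) (Fin M) ℝ) (i : Fin N) : ℝ :=
  -∑ j, W i j * Real.logb 2 (W i j)

/-- Mutual information `I(p, W) = ∑ᵢ pᵢ D(W(·|i) ‖ pW)`. -/
def mutualInfo (p : Fin N → ℝ) (W : Matrix (Fin N) (Fin M) ℝ) : ℝ :=
  ∑ i, p i * ∑ j, W i j * Real.logb 2 (W i j / output W p j)

/-- Capacity under the average input cost constraint `sᵀ p ≤ S`. -/
def capacity (W : Matrix (Fin N) (Fin M) ℝ) (s : Fin N → ℝ) (S : ℝ) : ℝ :=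
  sSup ((fun p => mutualInfo p W) '' {p | p ∈ stdSimplex ℝ (Fin N) ∧ ∑ i, s i * p i ≤ S})

/-- The least cost of an input distribution that maximizes the mutual information over the
whole simplex. -/
def costThreshold (W : Matrix (Fin N) (Fin M) ℝ) (s : Fin N → ℝ) : ℝ :=
  sInf ((fun p : Fin N → ℝ => ∑ i, s i * p i) ''
    {p | p ∈ stdSimplex ℝ (Fin N) ∧ ∀ p' ∈ stdSimplex ℝ (Fin N), mutualInfo p' W ≤ mutualInfo p W})

/-! ### The primal feasible set and the Lagrange dual -/

/-- Feasible input distributions of the reformulated problem: the whole simplex if there is no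
active cost constraint (`none`), and `{p ∈ Δ_N | sᵀ p = S}` for `some (s, S)`. -/
def feasible : Option ((Fin N → ℝ) × ℝ) → Set (Fin N → ℝ)
  | none => stdSimplex ℝ (Fin N)
  | some (s, S) => {p | p ∈ stdSimplex ℝ (Fin N) ∧ ∑ i, s i * p i = S}

/-- Which reformulation belongs to the capacity problem with constraint `sᵀ p ≤ S`: the equality
constraint if `S` is below the threshold, no constraint otherwise. -/
def Reformulates (W : Matrix (Fin N) (Fin M) ℝ) (c : Option ((Fin N → ℝ) × ℝ))
    (s : Fin N → ℝ) (S : ℝ) : Prop :=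
  (S < costThreshold W s ∧ c = some (s, S)) ∨ (costThreshold W s ≤ S ∧ c = none)

/-- `F(λ) = max {H(q) - λᵀ q | q ∈ Δ_M}`. -/
def F (lam : EuclideanSpace ℝ (Fin M)) : ℝ :=
  sSup ((fun q : Fin M → ℝ => entropy q - ∑ j, lam j * q j) '' stdSimplex ℝ (Fin M))

/-- `-rᵀ p + λᵀ Wᵀ p`. -/
def linObjective (W : Matrix (Fin N) (Fin M) ℝ) (lam : EuclideanSpace ℝ (Fin M))
    (p : Fin N → ℝ) : ℝ :=
  -(∑ i, condEntropy W i * p i) + ∑ j, lam j * output W p j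

/-- `G(λ)`, the maximum of `-rᵀ p + λᵀ Wᵀ p` over the feasible `p`. -/
def G (W : Matrix (Fin N) (Fin M) ℝ) (c : Option ((Fin N → ℝ) × ℝ))
    (lam : EuclideanSpace ℝ (Fin M)) : ℝ :=
  sSup (linObjective W lam '' feasible c)

/-! ### Smoothing -/

/-- `-rᵀ p + λᵀ Wᵀ p + ν H(p) - ν log N`. -/
def smoothObjective (W : Matrix (Fin N) (Fin M) ℝ) (ν : ℝ) (lam : EuclideanSpace ℝ (Fin M))
    (p : Fin N → ℝ) : ℝ :=
  linObjective W lam p + ν * entropy p - ν * Real.logb 2 N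

/-- The smoothed function `G_ν`. -/
def Gsmooth (W : Matrix (Fin N) (Fin M) ℝ) (c : Option ((Fin N → ℝ) × ℝ)) (ν : ℝ)
    (lam : EuclideanSpace ℝ (Fin M)) : ℝ :=
  sSup (smoothObjective W ν lam '' feasible c)

/-- `p_ν(λ)`, the (unique, for `ν > 0`) maximizer in the definition of `G_ν(λ)`. -/
def smoothMaximizer (W : Matrix (Fin N) (Fin M) ℝ) (c : Option ((Fin N → ℝ) × ℝ)) (ν : ℝ)
    (lam : EuclideanSpace ℝ (Fin M)) : Fin N → ℝ :=
  Classical.epsilon fun p => p ∈ feasible c ∧ IsMaxOn (smoothObjective W ν lam) (feasible c) p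

/-! ### The fast gradient scheme -/

/-- Projection onto the closed Euclidean ball of radius `R` about the origin. -/
def proj (R : ℝ) (x : EuclideanSpace ℝ (Fin M)) : EuclideanSpace ℝ (Fin M) :=
  if R < ‖x‖ then (R / ‖x‖) • x else x

section Scheme

variable (g : EuclideanSpace ℝ (Fin M) → EuclideanSpace ℝ (Fin M)) (L R : ℝ)
  (x₀ : EuclideanSpace ℝ (Fin M))

/-- The pair `(x_k, ∑_{i<k} (i+1)/2 • g(x_i))`. -/
def schemeState : ℕ → EuclideanSpace ℝ (Fin M) × EuclideanSpace ℝ (Fin M)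
  | 0 => (x₀, 0)
  | k + 1 =>
    let x := (schemeState k).1
    let a := (schemeState k).2 + (((k : ℝ) + 1) / 2) • g x
    ((2 / ((k : ℝ) + 3)) • proj R (-((1 / L) • a)) +
      (((k : ℝ) + 1) / ((k : ℝ) + 3)) • proj R (-((1 / L) • g x) + x), a)

/-- The query points `x_k`. -/
def schemeX (k : ℕ) : EuclideanSpace ℝ (Fin M) := (schemeState g L R x₀ k).1

/-- The gradient step `y_k`. -/
def schemeY (k : ℕ) : EuclideanSpace ℝ (Fin M) :=
  proj R (-((1 / L) • g (schemeX g L R x₀ k)) + schemeX g L R x₀ k)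

/-- The accumulated gradient step `z_k`. -/
def schemeZ (k : ℕ) : EuclideanSpace ℝ (Fin M) :=
  proj R (-((1 / L) • ∑ i ∈ Finset.range (k + 1), (((i : ℝ) + 1) / 2) • g (schemeX g L R x₀ i)))

theorem schemeState_snd (k : ℕ) : (schemeState g L R x₀ k).2 =
    ∑ i ∈ Finset.range k, (((i : ℝ) + 1) / 2) • g (schemeX g L R x₀ i) := by
  induction k with
  | zero => rfl
  | succ k ih => rw [Finset.sum_range_succ, ← ih]; rfl

theorem schemeX_zero : schemeX g L R x₀ 0 = x₀ := rfl

theorem schemeX_succ (k : ℕ) : schemeX g L R x₀ (k + 1) =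
    (2 / ((k : ℝ) + 3)) • schemeZ g L R x₀ k +
      (((k : ℝ) + 1) / ((k : ℝ) + 3)) • schemeY g L R x₀ k := by
  rw [schemeZ, Finset.sum_range_succ, ← schemeState_snd]; rfl

end Scheme

/-! ### The capacity algorithm -/

/-- The radius of the dual feasible ball `Q`. -/
def radius (M : ℕ) (γ : ℝ) : ℝ := M * max (Real.logb 2 γ⁻¹) (1 / Real.log 2)

/-- The dual feasible ball `Q`. -/
def Q (M : ℕ) (γ : ℝ) : Set (EuclideanSpace ℝ (Fin M)) := {lam | ‖lam‖ ≤ radius M γ}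

def D₁ (M : ℕ) (γ : ℝ) : ℝ := (1 / 2) * (max (M * Real.logb 2 γ⁻¹) (1 / Real.log 2)) ^ 2

def D₂ (N : ℕ) : ℝ := Real.logb 2 N

/-- The smoothing parameter for `n` iterations. -/
def smoothing (N M : ℕ) (γ : ℝ) (n : ℕ) : ℝ := 2 / ((n : ℝ) + 1) * √(D₁ M γ / D₂ N)

/-- `∇F + ∇G_ν`. -/
def smoothGradient (W : Matrix (Fin N) (Fin M) ℝ) (c : Option ((Fin N → ℝ) × ℝ)) (ν : ℝ)
    (x : EuclideanSpace ℝ (Fin M)) : EuclideanSpace ℝ (Fin M) :=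
  gradient F x + gradient (Gsmooth W c ν) x

/-- `x_k` for the run with smoothing parameter `ν(n)` and step constant `L_ν = 1 + 1/ν`. -/
def queryPoint (W : Matrix (Fin N) (Fin M) ℝ) (c : Option ((Fin N → ℝ) × ℝ)) (γ : ℝ)
    (x₀ : EuclideanSpace ℝ (Fin M)) (n k : ℕ) : EuclideanSpace ℝ (Fin M) :=
  schemeX (smoothGradient W c (smoothing N M γ n)) (1 + 1 / smoothing N M γ n) (radius M γ) x₀ k

/-- The approximate dual solution `λ̂ = y_n`. -/
def lamHat (W : Matrix (Fin N) (Fin M) ℝ) (c : Option ((Fin N → ℝ) × ℝ)) (γ : ℝ)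
    (x₀ : EuclideanSpace ℝ (Fin M)) (n : ℕ) : EuclideanSpace ℝ (Fin M) :=
  schemeY (smoothGradient W c (smoothing N M γ n)) (1 + 1 / smoothing N M γ n) (radius M γ) x₀ n

/-- The approximate optimal input distribution `p̂`. -/
def pHat (W : Matrix (Fin N) (Fin M) ℝ) (c : Option ((Fin N → ℝ) × ℝ)) (γ : ℝ)
    (x₀ : EuclideanSpace ℝ (Fin M)) (n : ℕ) : Fin N → ℝ :=
  ∑ k ∈ Finset.range (n + 1), (2 * ((k : ℝ) + 1) / (((n : ℝ) + 1) * ((n : ℝ) + 2))) •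
    smoothMaximizer W c (smoothing N M γ n) (queryPoint W c γ x₀ n k)

/-- `(λ, p)` solves the dual problem, its primal, and the capacity problems that reduce to it,
all up to an additive error `ε`. -/
structure IsEpsSolution (W : Matrix (Fin N) (Fin M) ℝ) (c : Option ((Fin N → ℝ) × ℝ)) (ε : ℝ)
    (lam : EuclideanSpace ℝ (Fin M)) (p : Fin N → ℝ) : Prop where
  mem : p ∈ feasible c
  gap : F lam + G W c lam - mutualInfo p W ≤ ε
  dual : ∀ lam', F lam + G W c lam ≤ F lam' + G W c lam' + ε
  primal : ∀ p' ∈ feasible c, mutualInfo p' W ≤ mutualInfo p W + ε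
  capacity_lower : ∀ s S, Reformulates W c s S →
    mutualInfo p W ≤ capacity W s S ∧ capacity W s S ≤ mutualInfo p W + ε
  capacity_upper : ∀ s S, Reformulates W c s S →
    capacity W s S ≤ F lam + G W c lam ∧ F lam + G W c lam ≤ capacity W s S + ε

/-- The bound on the number of iterations for accuracy `ε`. -/
def iterationBound (N M : ℕ) (γ ε : ℝ) : ℝ :=
  4 * √(D₁ M γ * D₂ N) * (1 / ε) + 2 * √(D₁ M γ / ε)

/-! ### Arithmetic operation counts -/

/-- `StraightLine k S`: there is a straight-line computation on real inputs `v : ι → ℝ` that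
performs `k` operations and whose available values, as functions of the input, are those in `S`.
Each natural constant, `+`, `-`, `*`, `/`, `max`, `√`, `exp` and `ln` costs one operation. -/
inductive StraightLine {ι : Type} : ℕ → Set ((ι → ℝ) → ℝ) → Prop
  | inputs : StraightLine 0 (Set.range fun i v => v i)
  | const {k S} (a : ℕ) : StraightLine k S → StraightLine (k + 1) (insert (fun _ => (a : ℝ)) S)
  | add {k S f h} : StraightLine k S → f ∈ S → h ∈ S →
      StraightLine (k + 1) (insert (fun v => f v + h v) S)
  | sub {k S f h} : StraightLine k S → f ∈ S → h ∈ S →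
      StraightLine (k + 1) (insert (fun v => f v - h v) S)
  | mul {k S f h} : StraightLine k S → f ∈ S → h ∈ S →
      StraightLine (k + 1) (insert (fun v => f v * h v) S)
  | div {k S f h} : StraightLine k S → f ∈ S → h ∈ S →
      StraightLine (k + 1) (insert (fun v => f v / h v) S)
  | max {k S f h} : StraightLine k S → f ∈ S → h ∈ S →
      StraightLine (k + 1) (insert (fun v => Max.max (f v) (h v)) S)
  | sqrt {k S f} : StraightLine k S → f ∈ S → StraightLine (k + 1) (insert (fun v => √(f v)) S)
  | exp {k S f} : StraightLine k S → f ∈ S →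
      StraightLine (k + 1) (insert (fun v => Real.exp (f v)) S)
  | log {k S f} : StraightLine k S → f ∈ S →
      StraightLine (k + 1) (insert (fun v => Real.log (f v)) S)

/-- The input of the algorithm: the entries of `W`, the coordinates of `x₀`, and `γ`. -/
def encode (W : Matrix (Fin N) (Fin M) ℝ) (x₀ : EuclideanSpace ℝ (Fin M)) (γ : ℝ) :
    (Fin N × Fin M) ⊕ Fin M ⊕ Unit → ℝ :=
  Sum.elim (fun ij => W ij.1 ij.2) (Sum.elim (fun j => x₀ j) fun _ => γ)

/-- For `N` inputs, `M` outputs and no cost constraint, one straight-line computation with `k`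
operations yields the results `λ̂` and `p̂` of `n` iterations, for all admissible data. -/
def RunsInOps (N M n k : ℕ) : Prop :=
  ∃ S : Set (((Fin N × Fin M) ⊕ Fin M ⊕ Unit → ℝ) → ℝ), StraightLine k S ∧
    ∃ (lam : Fin M → ((Fin N × Fin M) ⊕ Fin M ⊕ Unit → ℝ) → ℝ)
      (p : Fin N → ((Fin N × Fin M) ⊕ Fin M ⊕ Unit → ℝ) → ℝ),
      (∀ j, lam j ∈ S) ∧ (∀ i, p i ∈ S) ∧
      ∀ (W : Matrix (Fin N) (Fin M) ℝ) (γ : ℝ) (x₀ : EuclideanSpace ℝ (Fin M)),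
        IsChannel W → 0 < γ → (∀ i j, γ ≤ W i j) → x₀ ∈ Q M γ →
        (∀ j, lam j (encode W x₀ γ) = lamHat W none γ x₀ n j) ∧
        (∀ i, p i (encode W x₀ γ) = pHat W none γ x₀ n i)

end

end DMC

namespace DMC

variable {N M : ℕ}

/-! ### Entropy: Pinsker's inequality and strong concavity -/

/-! Writing $I(p,W)=H(W^\top p)-r^\top p$ and relaxing the coupling $q=W^\top p$ by a multiplier
$\lambda$ gives the dual $F+G$, so weak duality is immediate. Entropy in bits is strongly concave
with modulus 1 in $\ell^1$ (Pinsker's inequality, `entropy_strongConcave`). Since the rows of $W$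
have $\ell^1$-norm 1, the maxima $F$ and $G_\nu$ are differentiable, with quadratic upper bounds of
constants $1$ and $1/\nu$ (`sSup_regObjective_le`), while $G\le G_\nu+\nu\log N$. Nesterov's scheme
therefore applies to $F+G_\nu$ with $L=1+1/\nu$ (`fastGradient_le`).

The gap bound is a primal-dual argument. The tangent plane of $G_\nu$ at $x_k$, evaluated at $u$, is
the smoothed objective of $p_\nu(x_k)$ at $u$, hence at most its linear part; averaging with the
weights of the scheme produces the linear objective of $\hat p$ (`dualSmooth_le`). Testing with
$u=-\log(W^\top\hat p)$ bounds $F(u)$ plus that linear objective by $I(\hat p,W)$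
(`F_add_linObjective_outputMultiplier_le`), so strong duality is never needed. The chosen $\nu$
makes the smoothing error $\nu D_2$ equal to the $1/\nu$ part of the scheme's error.

The prox term is centred at 0 while $x_0\in Q$ is arbitrary, so the base case of the induction loses
up to $0.71R+1/4$. For $M\ge2$ slack in $D_1$ pays for this: $\|u\|^2\le M\log^2(1/\gamma)$ is at
most half of $(M\log(1/\gamma))^2=2D_1$ (`start_error_le`). For $M=1$ the gap is never positive.

The equality-constrained problem has the value of the capacity problem because a cheap input can be
mixed with an unconstrained optimum at no loss (`isLUB_capacity`). Without cost constraint the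
maximizers are Gibbs distributions, so an iteration takes $O(MN)$ operations (`computesFrom_step`).
-/

theorem monotoneOn_log_add_inv_sq :
    MonotoneOn (fun u : ℝ => Real.log u - 3 / 2 + 27 / 2 / (u + 2) ^ 2) (Set.Ioi 0) := by
  have hd : ∀ u : ℝ, 0 < u → HasDerivAt (fun u : ℝ => Real.log u - 3 / 2 + 27 / 2 / (u + 2) ^ 2)
      (u⁻¹ - 27 / (u + 2) ^ 3) u := by
    intro u hu
    have h1 : HasDerivAt (fun u : ℝ => (u + 2) ^ 2) (2 * (u + 2)) u := by
      simpa using ((hasDerivAt_id u).add_const (2 : ℝ)).fun_pow 2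
    have h2 := ((Real.hasDerivAt_log hu.ne').sub_const (3 / 2)).add
      (((hasDerivAt_const u (27 / 2 : ℝ)).div h1 (by positivity)))
    refine h2.congr_deriv ?_
    field_simp
    ring
  refine monotoneOn_of_deriv_nonneg (convex_Ioi 0)
    (fun u hu => (hd u hu).continuousAt.continuousWithinAt)
    (fun u hu => (hd u (interior_subset hu)).differentiableAt.differentiableWithinAt) ?_
  intro u hu
  have hu : 0 < u := interior_subset hu
  rw [(hd u hu).deriv, sub_nonneg, ← one_div, div_le_div_iff₀ (by positivity) hu]
  -- $(u+2)^3-27u=(u-1)^2(u+8)$.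
  nlinarith [mul_nonneg (sq_nonneg (u - 1)) (by linarith : 0 ≤ u + 8)]

/-- The difference of the two sides is $\frac23(u+2)h(u)$; both $h$ and $h'$ vanish at 1 and $h'$ is
increasing, so $h$ has its minimum there. The factor is affine in $u$ so that it can be summed
against probability vectors. -/
theorem sq_sub_one_le_mul_klFun {u : ℝ} (hu : 0 < u) :
    (u - 1) ^ 2 ≤ 2 / 3 * (u + 2) * (u * Real.log u - u + 1) := by
  set h : ℝ → ℝ := fun u => u * Real.log u - u + 1 - 3 / 2 * (u - 4 + 9 / (u + 2)) with hh
  have hd : ∀ u : ℝ, 0 < u →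
      HasDerivAt h (Real.log u - 3 / 2 + 27 / 2 / (u + 2) ^ 2) u := by
    intro u hu
    have h1 : HasDerivAt (fun u : ℝ => u + 2) 1 u := (hasDerivAt_id u).add_const 2
    have h2 := (((Real.hasDerivAt_mul_log hu.ne').sub (hasDerivAt_id u)).add_const 1).sub
      ((((hasDerivAt_id u).sub_const 4).add
        ((hasDerivAt_const u (9 : ℝ)).div h1 (by positivity))).const_mul (3 / 2))
    refine h2.congr_deriv ?_
    field_simp
    ring
  have hk1 : Real.log 1 - 3 / 2 + 27 / 2 / ((1 : ℝ) + 2) ^ 2 = 0 := by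
    rw [Real.log_one]; norm_num
  have h1 : h 1 = 0 := by simp only [hh, Real.log_one]; norm_num
  have key : 0 ≤ h u := by
    rw [← h1]
    rcases le_total u 1 with hu1 | hu1
    · have : AntitoneOn h (Set.Ioc 0 1) := by
        refine antitoneOn_of_deriv_nonpos (convex_Ioc 0 1)
          (fun u hu => (hd u hu.1).continuousAt.continuousWithinAt)
          (fun u hu => (hd u (interior_subset hu).1).differentiableAt.differentiableWithinAt) ?_
        intro v hv
        have hv := interior_subset hv
        rw [(hd v hv.1).deriv, ← hk1]
        exact monotoneOn_log_add_inv_sq hv.1 (Set.mem_Ioi.2 one_pos) hv.2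
      exact this ⟨hu, hu1⟩ ⟨one_pos, le_rfl⟩ hu1
    · have hpos : ∀ v ∈ Set.Ici (1 : ℝ), 0 < v := fun v hv => one_pos.trans_le hv
      have : MonotoneOn h (Set.Ici 1) := by
        refine monotoneOn_of_deriv_nonneg (convex_Ici 1)
          (fun u hu => (hd u (hpos u hu)).continuousAt.continuousWithinAt)
          (fun u hu =>
            (hd u (hpos u (interior_subset hu))).differentiableAt.differentiableWithinAt) ?_
        intro v hv
        have hv := interior_subset hv
        rw [(hd v (hpos v hv)).deriv, ← hk1]
        exact monotoneOn_log_add_inv_sq (Set.mem_Ioi.2 one_pos) (hpos v hv) hv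
      exact this (Set.mem_Ici.2 le_rfl) hu1 hu1
  have e : (u - 1) ^ 2 = (u + 2) * (u - 4 + 9 / (u + 2)) := by field_simp; ring
  rw [e]
  have : 0 ≤ (u + 2) * h u := mul_nonneg (by linarith) key
  simp only [hh] at this
  nlinarith

/-- Homogeneous form of the one-variable inequality: put $u=p/m$ and multiply by $m^2$. -/
theorem sq_sub_le_mul_relEntropy {p m : ℝ} (hp : 0 ≤ p) (hm : 0 ≤ m) (h0 : m = 0 → p = 0) :
    (p - m) ^ 2 ≤ (p * (Real.log p - Real.log m) - p + m) * (2 / 3 * (p + 2 * m)) := by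
  rcases hm.eq_or_lt with hm | hm
  · simp [← hm, h0 hm.symm]
  rcases hp.eq_or_lt with hp | hp
  · rw [← hp]; nlinarith
  have h := sq_sub_one_le_mul_klFun (div_pos hp hm)
  rw [Real.log_div hp.ne' hm.ne'] at h
  have e1 : (p - m) ^ 2 = m ^ 2 * (p / m - 1) ^ 2 := by field_simp
  have e2 : (p * (Real.log p - Real.log m) - p + m) * (2 / 3 * (p + 2 * m)) =
      m ^ 2 * (2 / 3 * (p / m + 2) * (p / m * (Real.log p - Real.log m) - p / m + 1)) := by
    field_simp
  rw [e1, e2]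
  gcongr

theorem relEntropy_term_nonneg {p m : ℝ} (hp : 0 ≤ p) (hm : 0 ≤ m) (h0 : m = 0 → p = 0) :
    0 ≤ p * (Real.log p - Real.log m) - p + m := by
  rcases hm.eq_or_lt with hm' | hm'
  · simp [← hm', h0 hm'.symm]
  by_contra! hlt
  nlinarith [sq_sub_le_mul_relEntropy hp hm h0, sq_nonneg (p - m),
    mul_pos_of_neg_of_neg hlt (by linarith : -(2 / 3 * (p + 2 * m)) < 0)]

/-- Pinsker's inequality for finite distributions. -/
theorem half_sq_l1_le_relEntropy {d : ℕ} {p m : Fin d → ℝ} (hp : p ∈ stdSimplex ℝ (Fin d))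
    (hm : m ∈ stdSimplex ℝ (Fin d)) (h0 : ∀ i, m i = 0 → p i = 0) :
    (∑ i, |p i - m i|) ^ 2 / 2 ≤ ∑ i, p i * (Real.log (p i) - Real.log (m i)) := by
  -- Cauchy–Schwarz: the factors $\frac23(p_i+2m_i)$ sum to 2 and the corrections $-p_i+m_i$ sum to
  -- 0.
  have h := Finset.sum_sq_le_sum_mul_sum_of_sq_le_mul Finset.univ (r := fun i => |p i - m i|)
    (f := fun i => p i * (Real.log (p i) - Real.log (m i)) - p i + m i)
    (g := fun i => 2 / 3 * (p i + 2 * m i))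
    (fun i _ => relEntropy_term_nonneg (hp.1 i) (hm.1 i) (h0 i))
    (fun i _ => by have := hp.1 i; have := hm.1 i; positivity)
    (fun i _ => by rw [sq_abs]; exact sq_sub_le_mul_relEntropy (hp.1 i) (hm.1 i) (h0 i))
  simp only [Finset.sum_add_distrib, Finset.sum_sub_distrib, ← Finset.mul_sum, hp.2, hm.2] at h
  linarith

theorem relEntropy_nonneg {d : ℕ} {p m : Fin d → ℝ} (hp : p ∈ stdSimplex ℝ (Fin d))
    (hm : m ∈ stdSimplex ℝ (Fin d)) (h0 : ∀ i, m i = 0 → p i = 0) :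
    0 ≤ ∑ i, p i * (Real.log (p i) - Real.log (m i)) :=
  le_trans (by positivity) (half_sq_l1_le_relEntropy hp hm h0)

theorem log_two_mul_entropy {d : ℕ} (p : Fin d → ℝ) :
    Real.log 2 * entropy p = ∑ i, -(p i * Real.log (p i)) := by
  have : Real.log 2 ≠ 0 := (Real.log_pos one_lt_two).ne'
  rw [entropy, Finset.mul_sum]
  refine Finset.sum_congr rfl fun i _ => ?_
  rw [Real.logb]
  field_simp

theorem continuous_entropy {d : ℕ} : Continuous (entropy : (Fin d → ℝ) → ℝ) := by
  have : (entropy : (Fin d → ℝ) → ℝ) = fun p => (∑ i, Real.negMulLog (p i)) / Real.log 2 := by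
    funext p
    rw [eq_div_iff (Real.log_pos one_lt_two).ne', mul_comm, log_two_mul_entropy]
    simp [Real.negMulLog]
  rw [this]
  fun_prop

/-- Entropy in bits is strongly concave with modulus `1` for the `ℓ¹`-norm. -/
theorem entropy_strongConcave {d : ℕ} {p q : Fin d → ℝ} (hp : p ∈ stdSimplex ℝ (Fin d))
    (hq : q ∈ stdSimplex ℝ (Fin d)) {s t : ℝ} (hs : 0 < s) (ht : 0 < t) (hst : s + t = 1) :
    s * entropy p + t * entropy q + s * t / 2 * (∑ i, |p i - q i|) ^ 2 ≤
      entropy (s • p + t • q) := by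
  set m := s • p + t • q with hm
  have hmS : m ∈ stdSimplex ℝ (Fin d) := convex_stdSimplex ℝ _ hp hq hs.le ht.le hst
  have hmi : ∀ i, m i = s * p i + t * q i := fun i => by simp [hm]
  have h0p : ∀ i, m i = 0 → p i = 0 := fun i h => by
    rw [hmi] at h
    have := mul_nonneg hs.le (hp.1 i); have := mul_nonneg ht.le (hq.1 i)
    exact (mul_eq_zero.1 (by linarith : s * p i = 0)).resolve_left hs.ne'
  have h0q : ∀ i, m i = 0 → q i = 0 := fun i h => by
    rw [hmi] at h
    have := mul_nonneg hs.le (hp.1 i); have := mul_nonneg ht.le (hq.1 i)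
    exact (mul_eq_zero.1 (by linarith : t * q i = 0)).resolve_left ht.ne'
  have h1 := half_sq_l1_le_relEntropy hp hmS h0p
  have h2 := half_sq_l1_le_relEntropy hq hmS h0q
  have e1 : ∑ i, |p i - m i| = t * ∑ i, |p i - q i| := by
    rw [Finset.mul_sum]
    refine Finset.sum_congr rfl fun i _ => ?_
    rw [← abs_of_pos ht, ← abs_mul, hmi]
    congr 1
    linear_combination (-p i) * hst
  have e2 : ∑ i, |q i - m i| = s * ∑ i, |p i - q i| := by
    rw [Finset.mul_sum]
    refine Finset.sum_congr rfl fun i _ => ?_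
    rw [← abs_of_pos hs, ← abs_mul, hmi, ← abs_neg]
    congr 1
    linear_combination (q i) * hst
  rw [e1] at h1
  rw [e2] at h2
  set D := ∑ i, |p i - q i|
  -- The concavity gap, in nats, is the weighted sum of the relative entropies to the mixture. With
  -- $p-m=t(p-q)$ and $q-m=-s(p-q)$, Pinsker yields the weight $st^2+ts^2=st$.
  have e3 : Real.log 2 * (entropy m - s * entropy p - t * entropy q) =
      s * (∑ i, p i * (Real.log (p i) - Real.log (m i))) +
        t * ∑ i, q i * (Real.log (q i) - Real.log (m i)) := by
    have : Real.log 2 * (entropy m - s * entropy p - t * entropy q) = Real.log 2 * entropy m -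
        s * (Real.log 2 * entropy p) - t * (Real.log 2 * entropy q) := by ring
    rw [this]
    simp only [log_two_mul_entropy, Finset.mul_sum, ← Finset.sum_sub_distrib,
      ← Finset.sum_add_distrib]
    refine Finset.sum_congr rfl fun i _ => ?_
    linear_combination (-Real.log (m i)) * hmi i
  have h3 : s * t / 2 * D ^ 2 ≤ Real.log 2 * (entropy m - s * entropy p - t * entropy q) := by
    rw [e3]
    have a1 := mul_le_mul_of_nonneg_left h1 hs.le
    have a2 := mul_le_mul_of_nonneg_left h2 ht.le
    have : s * ((t * D) ^ 2 / 2) + t * ((s * D) ^ 2 / 2) = s * t / 2 * D ^ 2 := by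
      linear_combination (s * t / 2 * D ^ 2) * hst
    linarith
  -- From nats to bits: the gap is nonnegative, so dropping the factor $\ln2\le1$ only enlarges it.
  have hlog : Real.log 2 ≤ 1 := by linarith [Real.log_two_lt_d9]
  have hX : 0 ≤ entropy m - s * entropy p - t * entropy q := by
    by_contra! hlt
    have : 0 ≤ s * t / 2 * D ^ 2 := by positivity
    nlinarith [Real.log_pos one_lt_two]
  nlinarith

theorem entropy_concave {d : ℕ} {p q : Fin d → ℝ} (hp : p ∈ stdSimplex ℝ (Fin d))
    (hq : q ∈ stdSimplex ℝ (Fin d)) {s t : ℝ} (hs : 0 < s) (ht : 0 < t) (hst : s + t = 1) :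
    s * entropy p + t * entropy q ≤ entropy (s • p + t • q) :=
  le_trans (le_add_of_nonneg_right (by positivity)) (entropy_strongConcave hp hq hs ht hst)

/-- Gibbs' inequality. -/
theorem entropy_le_crossEntropy {d : ℕ} {p q : Fin d → ℝ} (hp : p ∈ stdSimplex ℝ (Fin d))
    (hq : q ∈ stdSimplex ℝ (Fin d)) (hpos : ∀ i, 0 < q i) :
    entropy p ≤ -∑ i, p i * Real.logb 2 (q i) := by
  have h := relEntropy_nonneg hp hq fun i h => absurd h (hpos i).ne'
  have h2 := Real.log_pos one_lt_two
  refine le_of_mul_le_mul_left ?_ h2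
  rw [log_two_mul_entropy, mul_neg, Finset.mul_sum, ← Finset.sum_neg_distrib, ← sub_nonneg,
    ← Finset.sum_sub_distrib]
  refine h.trans_eq (Finset.sum_congr rfl fun i _ => ?_)
  rw [Real.logb]
  field_simp
  ring

theorem entropy_le_logb {d : ℕ} {p : Fin d → ℝ} (hp : p ∈ stdSimplex ℝ (Fin d)) :
    entropy p ≤ Real.logb 2 d := by
  have hd : (0 : ℝ) < d := by
    rcases Nat.eq_zero_or_pos d with rfl | h
    · simpa using hp.2
    · exact_mod_cast h
  have h := entropy_le_crossEntropy (q := fun _ => (d : ℝ)⁻¹) hp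
    ⟨fun _ => by positivity, by simp [hd.ne']⟩ (fun _ => by positivity)
  rwa [← Finset.sum_mul, hp.2, one_mul, Real.logb_inv, neg_neg] at h

/-! ### Maxima of entropy-regularized linear functions -/

/-- The linear function `aᵀ p + λᵀ Vᵀ p`, regularized by `ν H(p) + b`. -/
noncomputable def regObjective {d : ℕ} (a : Fin d → ℝ) (V : Matrix (Fin d) (Fin M) ℝ) (ν b : ℝ)
    (lam : EuclideanSpace ℝ (Fin M)) (p : Fin d → ℝ) : ℝ :=
  ∑ i, a i * p i + ∑ j, lam j * output V p j + ν * entropy p + b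

/-- `Vᵀ p` as a vector of Euclidean space. -/
noncomputable def outputVec {d : ℕ} (V : Matrix (Fin d) (Fin M) ℝ) (p : Fin d → ℝ) :
    EuclideanSpace ℝ (Fin M) :=
  WithLp.toLp 2 (output V p)

@[simp]
theorem outputVec_apply {d : ℕ} (V : Matrix (Fin d) (Fin M) ℝ) (p : Fin d → ℝ) (j : Fin M) :
    outputVec V p j = output V p j := rfl

theorem inner_eq_sum (x y : EuclideanSpace ℝ (Fin M)) : inner ℝ x y = ∑ j, y j * x j := by
  simp [PiLp.inner_apply]

theorem output_smul_add {d : ℕ} (V : Matrix (Fin d) (Fin M) ℝ) (p q : Fin d → ℝ) (s t : ℝ)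
    (j : Fin M) : output V (s • p + t • q) j = s * output V p j + t * output V q j := by
  simp only [output, Finset.mul_sum, ← Finset.sum_add_distrib]
  refine Finset.sum_congr rfl fun i _ => ?_
  simp only [Pi.add_apply, Pi.smul_apply, smul_eq_mul]
  ring

theorem continuous_output {d : ℕ} (V : Matrix (Fin d) (Fin M) ℝ) (j : Fin M) :
    Continuous fun p => output V p j := by
  unfold output
  fun_prop

section RegObjective

variable {d : ℕ} {a : Fin d → ℝ} {V : Matrix (Fin d) (Fin M) ℝ} {ν b : ℝ} {K : Set (Fin d → ℝ)}

theorem continuous_regObjective (lam : EuclideanSpace ℝ (Fin M)) :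
    Continuous (regObjective a V ν b lam) := by
  unfold regObjective
  have := continuous_entropy (d := d)
  have := continuous_output V
  fun_prop

theorem regObjective_add_inner (x y : EuclideanSpace ℝ (Fin M)) (p : Fin d → ℝ) :
    regObjective a V ν b x p + inner ℝ (outputVec V p) (y - x) = regObjective a V ν b y p := by
  have : inner ℝ (outputVec V p) (y - x) =
      ∑ j, y j * output V p j - ∑ j, x j * output V p j := by
    rw [inner_eq_sum, ← Finset.sum_sub_distrib]
    refine Finset.sum_congr rfl fun j _ => ?_
    simp only [PiLp.sub_apply, outputVec_apply]
    ring
  rw [this, regObjective, regObjective]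
  ring

/-- Each entry of $Vv$ is at most $\|v\|_2$, because rows of $V$ have $\ell^1$-norm at most 1 and
coordinates of $v$ are bounded by its norm. This is why $\ell^1$ strong concavity gives a smoothness
constant free of the dimensions. -/
theorem inner_outputVec_sub_le (hV : ∀ i, ∑ j, |V i j| ≤ 1) (p q : Fin d → ℝ)
    (v : EuclideanSpace ℝ (Fin M)) :
    inner ℝ (outputVec V p) v - inner ℝ (outputVec V q) v ≤ (∑ i, |p i - q i|) * ‖v‖ := by
  have e : inner ℝ (outputVec V p) v - inner ℝ (outputVec V q) v =
      ∑ i, (p i - q i) * ∑ j, V i j * v j := by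
    simp only [inner_eq_sum, outputVec_apply, output, ← Finset.sum_sub_distrib, Finset.mul_sum]
    rw [Finset.sum_comm]
    refine Finset.sum_congr rfl fun i _ => Finset.sum_congr rfl fun j _ => ?_
    ring
  rw [e, Finset.sum_mul]
  refine Finset.sum_le_sum fun i _ => ?_
  refine (le_abs_self _).trans ?_
  rw [abs_mul]
  refine mul_le_mul_of_nonneg_left ?_ (abs_nonneg _)
  calc |∑ j, V i j * v j| ≤ ∑ j, |V i j| * ‖v‖ := by
        refine (Finset.abs_sum_le_sum_abs _ _).trans (Finset.sum_le_sum fun j _ => ?_)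
        rw [abs_mul]
        exact mul_le_mul_of_nonneg_left (PiLp.norm_apply_le v j) (abs_nonneg _)
    _ = (∑ j, |V i j|) * ‖v‖ := by rw [Finset.sum_mul]
    _ ≤ ‖v‖ := mul_le_of_le_one_left (norm_nonneg v) (hV i)

theorem exists_isMaxOn_regObjective (hK : IsCompact K) (hne : K.Nonempty)
    (lam : EuclideanSpace ℝ (Fin M)) : ∃ p ∈ K, IsMaxOn (regObjective a V ν b lam) K p :=
  hK.exists_isMaxOn hne (continuous_regObjective lam).continuousOn

theorem sSup_image_eq_of_isMaxOn {X : Type*} {f : X → ℝ} {K : Set X} {p : X} (hp : p ∈ K)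
    (hmax : IsMaxOn f K p) : sSup (f '' K) = f p :=
  IsGreatest.csSup_eq ⟨Set.mem_image_of_mem f hp, Set.forall_mem_image.2 fun _ hq => hmax hq⟩

theorem regObjective_smul_add_le (hsub : K ⊆ stdSimplex ℝ (Fin d)) (hν : 0 ≤ ν)
    {p q : Fin d → ℝ} (hp : p ∈ K) (hq : q ∈ K) (lam : EuclideanSpace ℝ (Fin M)) {s t : ℝ}
    (hs : 0 < s) (ht : 0 < t) (hst : s + t = 1) :
    s * regObjective a V ν b lam p + t * regObjective a V ν b lam q +
      ν * (s * t / 2 * (∑ i, |p i - q i|) ^ 2) ≤ regObjective a V ν b lam (s • p + t • q) := by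
  have h := mul_le_mul_of_nonneg_left
    (entropy_strongConcave (hsub hp) (hsub hq) hs ht hst) hν
  have e1 : ∑ i, a i * (s • p + t • q) i = s * ∑ i, a i * p i + t * ∑ i, a i * q i := by
    simp only [Finset.mul_sum, ← Finset.sum_add_distrib]
    refine Finset.sum_congr rfl fun i _ => ?_
    simp only [Pi.add_apply, Pi.smul_apply, smul_eq_mul]
    ring
  have e2 : ∑ j, lam j * output V (s • p + t • q) j =
      s * ∑ j, lam j * output V p j + t * ∑ j, lam j * output V q j := by
    simp only [output_smul_add, Finset.mul_sum, ← Finset.sum_add_distrib]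
    refine Finset.sum_congr rfl fun i _ => ?_
    ring
  simp only [regObjective, e1, e2]
  have e3 : b = s * b + t * b := by rw [← add_mul, hst, one_mul]
  linarith

/-- Quadratic growth at a maximizer: compare $p$ with $tq+(1-t)p$, divide by $t$ and let $t\to0$. -/
theorem regObjective_add_sq_le (hconv : Convex ℝ K) (hsub : K ⊆ stdSimplex ℝ (Fin d))
    (hν : 0 ≤ ν) {lam : EuclideanSpace ℝ (Fin M)} {p q : Fin d → ℝ} (hp : p ∈ K)
    (hmax : IsMaxOn (regObjective a V ν b lam) K p) (hq : q ∈ K) :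
    regObjective a V ν b lam q + ν / 2 * (∑ i, |q i - p i|) ^ 2 ≤ regObjective a V ν b lam p := by
  set D := ∑ i, |q i - p i|
  set A := regObjective a V ν b lam q
  set B := regObjective a V ν b lam p
  have key : ∀ t ∈ Set.Ioo (0 : ℝ) 1, A + ν / 2 * D ^ 2 - B ≤ ν / 2 * D ^ 2 * t := by
    rintro t ⟨ht0, ht1⟩
    have h1 := regObjective_smul_add_le (a := a) (V := V) (b := b) hsub hν hq hp lam ht0
      (sub_pos.2 ht1) (by ring)
    have h2 := hmax (hconv hq hp ht0.le (sub_pos.2 ht1).le (by ring))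
    have h3 : t * A + (1 - t) * B + ν * (t * (1 - t) / 2 * D ^ 2) ≤ B := h1.trans h2
    have h4 : t * (A + ν / 2 * D ^ 2 - B) ≤ t * (ν / 2 * D ^ 2 * t) := by nlinarith
    exact le_of_mul_le_mul_left h4 ht0
  have hlim : Filter.Tendsto (fun t : ℝ => ν / 2 * D ^ 2 * t) (nhdsWithin 0 (Set.Ioi 0))
      (nhds (ν / 2 * D ^ 2 * 0)) :=
    ((continuous_const.mul continuous_id).tendsto 0).mono_left nhdsWithin_le_nhds
  have := ge_of_tendsto hlim (Filter.mem_of_superset (Ioo_mem_nhdsGT one_pos) key)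
  linarith

theorem isMaxOn_regObjective_unique (hconv : Convex ℝ K) (hsub : K ⊆ stdSimplex ℝ (Fin d))
    (hν : 0 < ν) {lam : EuclideanSpace ℝ (Fin M)} {p q : Fin d → ℝ} (hp : p ∈ K)
    (hpmax : IsMaxOn (regObjective a V ν b lam) K p) (hq : q ∈ K)
    (hqmax : IsMaxOn (regObjective a V ν b lam) K q) : q = p := by
  have h1 := regObjective_add_sq_le hconv hsub hν.le hp hpmax hq
  have h2 : regObjective a V ν b lam p ≤ regObjective a V ν b lam q := hqmax hp
  have h3 : (∑ i, |q i - p i|) ^ 2 = 0 := by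
    refine le_antisymm ?_ (sq_nonneg _)
    by_contra! h
    have := mul_pos (half_pos hν) h
    linarith
  have h4 := (Finset.sum_eq_zero_iff_of_nonneg fun i _ => abs_nonneg _).1
    (pow_eq_zero_iff two_ne_zero |>.1 h3)
  funext i
  exact sub_eq_zero.1 (abs_eq_zero.1 (h4 i (Finset.mem_univ i)))

/-- The linearization of the maximum at `x` is a lower bound. -/
theorem add_inner_le_sSup_regObjective (hK : IsCompact K) {p : Fin d → ℝ} (hp : p ∈ K)
    (x y : EuclideanSpace ℝ (Fin M)) :
    regObjective a V ν b x p + inner ℝ (outputVec V p) (y - x) ≤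
      sSup (regObjective a V ν b y '' K) := by
  rw [regObjective_add_inner]
  exact le_csSup (hK.image (continuous_regObjective y)).bddAbove (Set.mem_image_of_mem _ hp)

/-- The maximum is smooth with constant `1 / ν`. -/
theorem sSup_regObjective_le (hK : IsCompact K) (hconv : Convex ℝ K)
    (hsub : K ⊆ stdSimplex ℝ (Fin d)) (hν : 0 < ν) (hV : ∀ i, ∑ j, |V i j| ≤ 1)
    {x : EuclideanSpace ℝ (Fin M)} {p : Fin d → ℝ} (hp : p ∈ K)
    (hmax : IsMaxOn (regObjective a V ν b x) K p) (y : EuclideanSpace ℝ (Fin M)) :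
    sSup (regObjective a V ν b y '' K) ≤
      regObjective a V ν b x p + inner ℝ (outputVec V p) (y - x) + 1 / ν / 2 * ‖y - x‖ ^ 2 := by
  obtain ⟨q, hq, hqmax⟩ := exists_isMaxOn_regObjective (a := a) (V := V) (ν := ν) (b := b) hK
    ⟨p, hp⟩ y
  rw [sSup_image_eq_of_isMaxOn hq hqmax, ← regObjective_add_inner x y q]
  have h1 := regObjective_add_sq_le hconv hsub hν.le hp hmax hq
  have h2 := inner_outputVec_sub_le hV q p (y - x)
  set D := ∑ i, |q i - p i|
  -- Young's inequality, weighted so that quadratic growth absorbs the $D^2$ term.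
  have h3 : D * ‖y - x‖ ≤ ν / 2 * D ^ 2 + 1 / ν / 2 * ‖y - x‖ ^ 2 := by
    have : ν / 2 * D ^ 2 + 1 / ν / 2 * ‖y - x‖ ^ 2 - D * ‖y - x‖ =
        (ν * D - ‖y - x‖) ^ 2 / (2 * ν) := by field_simp; ring
    have : 0 ≤ (ν * D - ‖y - x‖) ^ 2 / (2 * ν) := by positivity
    linarith
  linarith

theorem hasGradientAt_of_quadratic_bounds {f : EuclideanSpace ℝ (Fin M) → ℝ}
    {g x : EuclideanSpace ℝ (Fin M)} {L : ℝ} (hlo : ∀ y, f x + inner ℝ g (y - x) ≤ f y)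
    (hup : ∀ y, f y ≤ f x + inner ℝ g (y - x) + L * ‖y - x‖ ^ 2) : HasGradientAt f g x := by
  rw [hasGradientAt_iff_isLittleO]
  have h1 : (fun y => f y - f x - inner ℝ g (y - x)) =O[nhds x] fun y => ‖y - x‖ ^ 2 := by
    refine Asymptotics.IsBigO.of_bound L (Filter.Eventually.of_forall fun y => ?_)
    rw [Real.norm_of_nonneg (by linarith [hlo y]), Real.norm_of_nonneg (by positivity)]
    linarith [hup y]
  refine h1.trans_isLittleO ?_
  have h2 : (fun y => y - x) =o[nhds x] fun _ => (1 : ℝ) := by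
    rw [Asymptotics.isLittleO_one_iff]
    have : Continuous fun y : EuclideanSpace ℝ (Fin M) => y - x := by fun_prop
    simpa using this.tendsto x
  have h3 := (h2.norm_left).mul_isBigO (Asymptotics.isBigO_refl (fun y => ‖y - x‖) (nhds x))
  simpa [sq] using h3

/-- Danskin's formula: the maximum is squeezed between an affine function and that function plus
$O(\|y-x\|^2)$. -/
theorem hasGradientAt_sSup_regObjective (hK : IsCompact K) (hconv : Convex ℝ K)
    (hsub : K ⊆ stdSimplex ℝ (Fin d)) (hν : 0 < ν) (hV : ∀ i, ∑ j, |V i j| ≤ 1)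
    {x : EuclideanSpace ℝ (Fin M)} {p : Fin d → ℝ} (hp : p ∈ K)
    (hmax : IsMaxOn (regObjective a V ν b x) K p) :
    HasGradientAt (fun y => sSup (regObjective a V ν b y '' K)) (outputVec V p) x := by
  have e := sSup_image_eq_of_isMaxOn hp hmax
  refine hasGradientAt_of_quadratic_bounds (L := 1 / ν / 2) (fun y => ?_) fun y => ?_
  · rw [e]; exact add_inner_le_sSup_regObjective hK hp x y
  · rw [e]; exact sSup_regObjective_le hK hconv hsub hν hV hp hmax y

end RegObjective

/-! ### The fast gradient scheme -/

theorem norm_proj_le {R : ℝ} (hR : 0 ≤ R) (x : EuclideanSpace ℝ (Fin M)) : ‖proj R x‖ ≤ R := by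
  unfold proj
  split_ifs with h
  · have : 0 < ‖x‖ := hR.trans_lt h
    rw [norm_smul, Real.norm_of_nonneg (by positivity), div_mul_cancel₀ _ this.ne']
  · exact not_lt.1 h

/-- The obtuse-angle property. Outside the ball $w-\pi(w)$ is a nonnegative multiple of $w$, and
Cauchy–Schwarz gives $\langle w,u\rangle\le\|w\|R=\langle w,\pi(w)\rangle$. -/
theorem inner_sub_proj_nonpos {R : ℝ} (hR : 0 ≤ R) (w : EuclideanSpace ℝ (Fin M))
    {u : EuclideanSpace ℝ (Fin M)} (hu : ‖u‖ ≤ R) :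
    inner ℝ (w - proj R w) (u - proj R w) ≤ 0 := by
  unfold proj
  split_ifs with h
  · have hw : 0 < ‖w‖ := hR.trans_lt h
    have e1 : w - (R / ‖w‖) • w = (1 - R / ‖w‖) • w := by rw [sub_smul, one_smul]
    have h1 : inner ℝ w u ≤ ‖w‖ * R :=
      (real_inner_le_norm w u).trans (mul_le_mul_of_nonneg_left hu hw.le)
    have e2 : R / ‖w‖ * ‖w‖ ^ 2 = ‖w‖ * R := by field_simp
    rw [e1, inner_smul_left, inner_sub_right, inner_smul_right, real_inner_self_eq_norm_sq, e2]
    have h2 : R / ‖w‖ ≤ 1 := (div_le_one hw).2 h.le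
    simp only [conj_trivial]
    exact mul_nonpos_of_nonneg_of_nonpos (by linarith) (by linarith)
  · simp

/-- The projected gradient step minimizes the quadratic model over the ball. -/
theorem proj_step_le {R L : ℝ} (hR : 0 ≤ R) (hL : 0 < L) (g x : EuclideanSpace ℝ (Fin M))
    {u : EuclideanSpace ℝ (Fin M)} (hu : ‖u‖ ≤ R) :
    inner ℝ g (proj R (-((1 / L) • g) + x) - x) +
        L / 2 * ‖proj R (-((1 / L) • g) + x) - x‖ ^ 2 +
        L / 2 * ‖u - proj R (-((1 / L) • g) + x)‖ ^ 2 ≤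
      inner ℝ g (u - x) + L / 2 * ‖u - x‖ ^ 2 := by
  have h := inner_sub_proj_nonpos hR (-((1 / L) • g) + x) hu
  set z := proj R (-((1 / L) • g) + x)
  have e1 : u - x = (u - z) + (z - x) := by abel
  have e2 : -((1 / L) • g) + x - z = -((1 / L) • g) - (z - x) := by abel
  rw [e2, inner_sub_left, inner_neg_left, inner_smul_left] at h
  simp only [conj_trivial] at h
  rw [e1, inner_add_right, norm_add_sq_real, real_inner_comm (z - x) (u - z)]
  have h' := mul_nonneg hL.le (sub_nonneg.2 h)
  have e3 : L * (0 - (-(1 / L * inner ℝ g (u - z)) - inner ℝ (z - x) (u - z))) =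
      inner ℝ g (u - z) + L * inner ℝ (z - x) (u - z) := by field_simp; ring
  rw [e3] at h'
  linarith

section FastGradient

variable {f : EuclideanSpace ℝ (Fin M) → ℝ}
  {g : EuclideanSpace ℝ (Fin M) → EuclideanSpace ℝ (Fin M)} {L R e : ℝ}
  {x₀ : EuclideanSpace ℝ (Fin M)}

theorem norm_smul_add_smul_le {u v : EuclideanSpace ℝ (Fin M)} (hu : ‖u‖ ≤ R) (hv : ‖v‖ ≤ R)
    {s t : ℝ} (hs : 0 ≤ s) (ht : 0 ≤ t) (hst : s + t = 1) : ‖s • u + t • v‖ ≤ R := by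
  have h := convex_closedBall (0 : EuclideanSpace ℝ (Fin M)) R (mem_closedBall_zero_iff.2 hu)
    (mem_closedBall_zero_iff.2 hv) hs ht hst
  exact mem_closedBall_zero_iff.1 h

/-- The estimate function: the accumulated linear models of `f` plus the prox term. -/
noncomputable def estimate (f : EuclideanSpace ℝ (Fin M) → ℝ)
    (g : EuclideanSpace ℝ (Fin M) → EuclideanSpace ℝ (Fin M)) (L R : ℝ)
    (x₀ : EuclideanSpace ℝ (Fin M)) (k : ℕ) (u : EuclideanSpace ℝ (Fin M)) : ℝ :=
  L / 2 * ‖u‖ ^ 2 + ∑ i ∈ Finset.range (k + 1), ((i : ℝ) + 1) / 2 *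
    (f (schemeX g L R x₀ i) + inner ℝ (g (schemeX g L R x₀ i)) (u - schemeX g L R x₀ i))

/-- Up to a constant the estimate function is a linear form plus $\frac L2\|u\|^2$, so $z_k$, a
projected step from the origin along the accumulated gradient, minimizes it over the ball with
quadratic growth. -/
theorem estimate_schemeZ_add_le (hR : 0 ≤ R) (hL : 0 < L) (k : ℕ)
    {u : EuclideanSpace ℝ (Fin M)} (hu : ‖u‖ ≤ R) :
    estimate f g L R x₀ k (schemeZ g L R x₀ k) + L / 2 * ‖u - schemeZ g L R x₀ k‖ ^ 2 ≤
      estimate f g L R x₀ k u := by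
  set a := ∑ i ∈ Finset.range (k + 1), (((i : ℝ) + 1) / 2) • g (schemeX g L R x₀ i) with ha
  have e : ∀ v, estimate f g L R x₀ k v = inner ℝ a v + L / 2 * ‖v‖ ^ 2 +
      ∑ i ∈ Finset.range (k + 1), ((i : ℝ) + 1) / 2 *
        (f (schemeX g L R x₀ i) - inner ℝ (g (schemeX g L R x₀ i)) (schemeX g L R x₀ i)) := by
    intro v
    rw [estimate, ha, sum_inner, add_comm, add_right_comm, ← Finset.sum_add_distrib]
    congr 1
    refine Finset.sum_congr rfl fun i _ => ?_
    rw [inner_smul_left, inner_sub_right]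
    simp only [conj_trivial]
    ring
  have h := proj_step_le hR hL a 0 hu
  simp only [add_zero, sub_zero] at h
  have hz : schemeZ g L R x₀ k = proj R (-((1 / L) • a)) := rfl
  rw [e, e, hz]
  linarith

theorem estimate_succ (k : ℕ) (u : EuclideanSpace ℝ (Fin M)) :
    estimate f g L R x₀ (k + 1) u = estimate f g L R x₀ k u + ((k : ℝ) + 2) / 2 *
      (f (schemeX g L R x₀ (k + 1)) +
        inner ℝ (g (schemeX g L R x₀ (k + 1))) (u - schemeX g L R x₀ (k + 1))) := by
  rw [estimate, Finset.sum_range_succ, ← add_assoc, estimate]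
  push_cast
  ring

theorem schemeY_step (hR : 0 ≤ R) (hL : 0 < L)
    (hup : ∀ x y, f y ≤ f x + inner ℝ (g x) (y - x) + L / 2 * ‖y - x‖ ^ 2) (k : ℕ)
    {w : EuclideanSpace ℝ (Fin M)} (hw : ‖w‖ ≤ R) :
    f (schemeY g L R x₀ k) ≤ f (schemeX g L R x₀ k) +
      inner ℝ (g (schemeX g L R x₀ k)) (w - schemeX g L R x₀ k) +
        L / 2 * ‖w - schemeX g L R x₀ k‖ ^ 2 := by
  have h1 := hup (schemeX g L R x₀ k) (schemeY g L R x₀ k)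
  have h2 := proj_step_le hR hL (g (schemeX g L R x₀ k)) (schemeX g L R x₀ k) hw
  have h3 : schemeY g L R x₀ k = proj R (-((1 / L) • g (schemeX g L R x₀ k)) +
    schemeX g L R x₀ k) := rfl
  rw [← h3] at h2
  have : 0 ≤ L / 2 * ‖w - schemeY g L R x₀ k‖ ^ 2 := by positivity
  linarith

/-- Nesterov's invariant for the weights $\alpha_i=(i+1)/2$ with partial sums $A_k=(k+1)(k+2)/4$.
The error $e$ enters at $k=0$ only and is carried along unchanged. -/
theorem mul_schemeY_le_estimate (hR : 0 ≤ R) (hL : 0 < L) (hx₀ : ‖x₀‖ ≤ R)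
    (hlo : ∀ x y, f x + inner ℝ (g x) (y - x) ≤ f y)
    (hup : ∀ x y, f y ≤ f x + inner ℝ (g x) (y - x) + L / 2 * ‖y - x‖ ^ 2)
    (he : inner ℝ (g x₀) (x₀ - schemeZ g L R x₀ 0) / 2 - L / 2 * ‖schemeZ g L R x₀ 0‖ ^ 2 ≤ e)
    (k : ℕ) :
    ((k : ℝ) + 1) * (k + 2) / 4 * f (schemeY g L R x₀ k) ≤
      estimate f g L R x₀ k (schemeZ g L R x₀ k) + e := by
  induction k with
  | zero =>
    -- With $x_0$ itself as test point this reads $f(y_0)\le f(x_0)$.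
    have h1 := schemeY_step (x₀ := x₀) hR hL hup 0 hx₀
    rw [schemeX_zero, sub_self, inner_zero_right, norm_zero] at h1
    have h2 : inner ℝ (g x₀) (schemeZ g L R x₀ 0 - x₀) =
        -inner ℝ (g x₀) (x₀ - schemeZ g L R x₀ 0) := by rw [← inner_neg_right, neg_sub]
    simp only [estimate, zero_add, Finset.sum_range_one, schemeX_zero, h2, Nat.cast_zero]
    linarith
  | succ k ih =>
    set x := schemeX g L R x₀ (k + 1) with hx
    set y := schemeY g L R x₀ k
    set z := schemeZ g L R x₀ k
    set z' := schemeZ g L R x₀ (k + 1)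
    have hz' : ‖z'‖ ≤ R := norm_proj_le hR _
    have hy : ‖y‖ ≤ R := norm_proj_le hR _
    -- $\tau=\alpha_{k+1}/A_{k+1}$ and $1-\tau=A_k/A_{k+1}$.
    set τ : ℝ := 2 / ((k : ℝ) + 3) with hτ
    have hx' : x = τ • z + (((k : ℝ) + 1) / ((k : ℝ) + 3)) • y := schemeX_succ g L R x₀ k
    -- The test point is $x_{k+1}$ with $z_k$ replaced by $z_{k+1}$, so that
    -- $w-x_{k+1}=\tau(z_{k+1}-z_k)$.
    set w := τ • z' + (((k : ℝ) + 1) / ((k : ℝ) + 3)) • y with hw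
    have hwR : ‖w‖ ≤ R := norm_smul_add_smul_le hz' hy (by positivity) (by positivity)
      (by rw [hτ]; field_simp; ring)
    have hwx : w - x = τ • (z' - z) := by rw [hw, hx', smul_sub]; abel
    have h1 := schemeY_step (x₀ := x₀) hR hL hup (k + 1) hwR
    rw [← hx] at h1
    have h2 := estimate_schemeZ_add_le (f := f) (g := g) (x₀ := x₀) hR hL k hz'
    have h3 := hlo x y
    rw [estimate_succ]
    have h4 : inner ℝ (g x) (w - x) = τ * inner ℝ (g x) (z' - x) +
        ((k : ℝ) + 1) / ((k : ℝ) + 3) * inner ℝ (g x) (y - x) := by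
      have : w - x = τ • (z' - x) + (((k : ℝ) + 1) / ((k : ℝ) + 3)) • (y - x) := by
        have h1 : x = (τ + ((k : ℝ) + 1) / ((k : ℝ) + 3)) • x := by
          rw [hτ, ← add_div, show 2 + ((k : ℝ) + 1) = k + 3 by ring,
            div_self (by positivity), one_smul]
        conv_lhs => rw [h1]
        rw [hw, add_smul, smul_sub, smul_sub]
        abel
      rw [this, inner_add_right, inner_smul_right, inner_smul_right]
    have h5 : ‖w - x‖ ^ 2 = τ ^ 2 * ‖z' - z‖ ^ 2 := by
      rw [hwx, norm_smul, mul_pow, Real.norm_eq_abs, sq_abs]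
    rw [h4, h5] at h1
    have hk : (0 : ℝ) ≤ k := k.cast_nonneg
    have h6 := mul_le_mul_of_nonneg_left h1
      (by positivity : 0 ≤ ((k : ℝ) + 2) * (k + 3) / 4)
    have h7 := mul_le_mul_of_nonneg_left h3 (by positivity : 0 ≤ ((k : ℝ) + 1) * (k + 2) / 4)
    -- $A_{k+1}\tau^2=(k+2)/(k+3)\le1$, so the growth of the estimate function at $z_k$ covers this
    -- term.
    have h8 : ((k : ℝ) + 2) * (k + 3) / 4 * (L / 2 * (τ ^ 2 * ‖z' - z‖ ^ 2)) ≤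
        L / 2 * ‖z' - z‖ ^ 2 := by
      have e1 : ((k : ℝ) + 2) * (k + 3) / 4 * (L / 2 * (τ ^ 2 * ‖z' - z‖ ^ 2)) =
          ((k : ℝ) + 2) / (k + 3) * (L / 2 * ‖z' - z‖ ^ 2) := by rw [hτ]; field_simp; ring
      rw [e1]
      exact mul_le_of_le_one_left (by positivity)
        ((div_le_one (by positivity)).2 (by linarith))
    have e2 : ((k : ℝ) + 2) * (k + 3) / 4 * (f x + (τ * inner ℝ (g x) (z' - x) +
        ((k : ℝ) + 1) / ((k : ℝ) + 3) * inner ℝ (g x) (y - x)) +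
          L / 2 * (τ ^ 2 * ‖z' - z‖ ^ 2)) =
        ((k : ℝ) + 1) * (k + 2) / 4 * (f x + inner ℝ (g x) (y - x)) +
        ((k : ℝ) + 2) / 2 * (f x + inner ℝ (g x) (z' - x)) +
        ((k : ℝ) + 2) * (k + 3) / 4 * (L / 2 * (τ ^ 2 * ‖z' - z‖ ^ 2)) := by
      rw [hτ]; field_simp; ring
    rw [e2] at h6
    have e3 : (((k + 1 : ℕ) : ℝ) + 1) * (((k + 1 : ℕ) : ℝ) + 2) / 4 =
        ((k : ℝ) + 2) * (k + 3) / 4 := by push_cast; ring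
    rw [e3]
    linarith

/-- Convergence of the fast gradient scheme with an arbitrary starting point; `e` bounds the
loss caused by not starting at the prox centre. -/
theorem fastGradient_le (hR : 0 ≤ R) (hL : 0 < L) (hx₀ : ‖x₀‖ ≤ R)
    (hlo : ∀ x y, f x + inner ℝ (g x) (y - x) ≤ f y)
    (hup : ∀ x y, f y ≤ f x + inner ℝ (g x) (y - x) + L / 2 * ‖y - x‖ ^ 2)
    (he : ‖g x₀‖ * R / 2 + ‖g x₀‖ ^ 2 / (8 * L) ≤ e) (k : ℕ)
    {u : EuclideanSpace ℝ (Fin M)} (hu : ‖u‖ ≤ R) :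
    ((k : ℝ) + 1) * (k + 2) / 4 * f (schemeY g L R x₀ k) ≤ estimate f g L R x₀ k u + e := by
  have h1 := estimate_schemeZ_add_le (f := f) (g := g) (x₀ := x₀) hR hL k hu
  have h2 : 0 ≤ L / 2 * ‖u - schemeZ g L R x₀ k‖ ^ 2 := by positivity
  refine (mul_schemeY_le_estimate hR hL hx₀ hlo hup (le_trans ?_ he) k).trans (by linarith)
  set z := schemeZ g L R x₀ 0
  have h3 : inner ℝ (g x₀) (x₀ - z) ≤ ‖g x₀‖ * R + ‖g x₀‖ * ‖z‖ := by
    refine (real_inner_le_norm _ _).trans ?_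
    rw [← mul_add]
    exact mul_le_mul_of_nonneg_left ((norm_sub_le _ _).trans (by linarith)) (norm_nonneg _)
  -- Complete the square in $\|z\|$.
  have h4 : ‖g x₀‖ * ‖z‖ / 2 - L / 2 * ‖z‖ ^ 2 ≤ ‖g x₀‖ ^ 2 / (8 * L) := by
    have : ‖g x₀‖ ^ 2 / (8 * L) - (‖g x₀‖ * ‖z‖ / 2 - L / 2 * ‖z‖ ^ 2) =
        (‖g x₀‖ - 2 * L * ‖z‖) ^ 2 / (8 * L) := by field_simp; ring
    have : 0 ≤ (‖g x₀‖ - 2 * L * ‖z‖) ^ 2 / (8 * L) := by positivity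
    linarith
  linarith

end FastGradient

/-! ### Gibbs distributions -/

/-- The Gibbs distribution with weights `exp (t i)`. -/
noncomputable def gibbs {d : ℕ} (t : Fin d → ℝ) (i : Fin d) : ℝ :=
  Real.exp (t i) / ∑ k, Real.exp (t k)

theorem sum_exp_pos {d : ℕ} (hd : 0 < d) (t : Fin d → ℝ) : 0 < ∑ k, Real.exp (t k) :=
  Finset.sum_pos (fun _ _ => Real.exp_pos _) ⟨⟨0, hd⟩, Finset.mem_univ _⟩

theorem gibbs_pos {d : ℕ} (t : Fin d → ℝ) (i : Fin d) : 0 < gibbs t i :=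
  div_pos (Real.exp_pos _) (sum_exp_pos i.pos t)

theorem gibbs_mem {d : ℕ} (hd : 0 < d) (t : Fin d → ℝ) : gibbs t ∈ stdSimplex ℝ (Fin d) :=
  ⟨fun i => (gibbs_pos t i).le, by
    simp only [gibbs, ← Finset.sum_div]; exact div_self (sum_exp_pos hd t).ne'⟩

/-- The Gibbs distribution maximizes the regularized objective over the whole simplex. -/
theorem isMaxOn_gibbs {d : ℕ} (hd : 0 < d) {a : Fin d → ℝ} {V : Matrix (Fin d) (Fin M) ℝ}
    {ν b : ℝ} (hν : 0 < ν) (lam : EuclideanSpace ℝ (Fin M)) :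
    IsMaxOn (regObjective a V ν b lam) (stdSimplex ℝ (Fin d))
      (gibbs fun i => (∑ j, V i j * lam j + a i) * Real.log 2 / ν) := by
  set t : Fin d → ℝ := fun i => (∑ j, V i j * lam j + a i) * Real.log 2 / ν with ht
  have h2 : Real.log 2 ≠ 0 := (Real.log_pos one_lt_two).ne'
  set Z := ∑ k, Real.exp (t k)
  have hZ : 0 < Z := sum_exp_pos hd t
  -- Up to a constant the objective is $-\nu$ times the relative entropy, in bits, of $p$ to the
  -- Gibbs distribution.
  have e : ∀ p ∈ stdSimplex ℝ (Fin d), regObjective a V ν b lam p =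
      ν * (entropy p + ∑ i, p i * Real.logb 2 (gibbs t i)) + ν * (Real.log Z / Real.log 2) + b := by
    intro p hp
    have e1 : ∑ i, p i * Real.logb 2 (gibbs t i) =
        (∑ i, a i * p i + ∑ j, lam j * output V p j) / ν - Real.log Z / Real.log 2 := by
      have e2 : ∑ j, lam j * output V p j = ∑ i, p i * ∑ j, V i j * lam j := by
        simp only [output, Finset.mul_sum]
        rw [Finset.sum_comm]
        refine Finset.sum_congr rfl fun i _ => Finset.sum_congr rfl fun j _ => ?_
        ring
      have e3 : Real.log Z / Real.log 2 = ∑ i, p i * (Real.log Z / Real.log 2) := by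
        rw [← Finset.sum_mul, hp.2, one_mul]
      rw [e2, e3, ← Finset.sum_add_distrib, Finset.sum_div, ← Finset.sum_sub_distrib]
      refine Finset.sum_congr rfl fun i _ => ?_
      rw [gibbs, Real.logb, Real.log_div (Real.exp_ne_zero _) hZ.ne', Real.log_exp]
      simp only [ht]
      field_simp
      ring
    rw [e1, regObjective]
    field_simp
    ring
  intro p hp
  have hq := gibbs_mem hd t
  have h1 := entropy_le_crossEntropy hp hq (gibbs_pos t)
  have h3 : entropy (gibbs t) + ∑ i, gibbs t i * Real.logb 2 (gibbs t i) = 0 := by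
    simp [entropy]
  change regObjective a V ν b lam p ≤ regObjective a V ν b lam (gibbs t)
  rw [e p hp, e _ hq, h3]
  have := mul_le_mul_of_nonneg_left
    (by linarith : entropy p + ∑ i, p i * Real.logb 2 (gibbs t i) ≤ 0) hν.le
  linarith

/-! ### The feasible set and the two parts of the dual function -/

theorem feasible_subset (c : Option ((Fin N → ℝ) × ℝ)) : feasible c ⊆ stdSimplex ℝ (Fin N) := by
  rcases c with _ | ⟨s, S⟩
  · exact subset_rfl
  · exact fun p hp => hp.1

theorem isCompact_feasible (c : Option ((Fin N → ℝ) × ℝ)) : IsCompact (feasible c) := by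
  rcases c with _ | ⟨s, S⟩
  · exact isCompact_stdSimplex ℝ (Fin N)
  · exact (isCompact_stdSimplex ℝ (Fin N)).inter_right
      (isClosed_eq (by fun_prop) continuous_const)

theorem sum_mul_smul_add (s p q : Fin N → ℝ) (a b : ℝ) :
    ∑ i, s i * (a • p + b • q) i = a * ∑ i, s i * p i + b * ∑ i, s i * q i := by
  simp only [Finset.mul_sum, ← Finset.sum_add_distrib]
  refine Finset.sum_congr rfl fun i _ => ?_
  simp only [Pi.add_apply, Pi.smul_apply, smul_eq_mul]
  ring

theorem convex_feasible (c : Option ((Fin N → ℝ) × ℝ)) : Convex ℝ (feasible c) := by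
  rcases c with _ | ⟨s, S⟩
  · exact convex_stdSimplex ℝ (Fin N)
  · rintro p ⟨hp, hpS⟩ q ⟨hq, hqS⟩ a b ha hb hab
    refine ⟨convex_stdSimplex ℝ _ hp hq ha hb hab, ?_⟩
    rw [sum_mul_smul_add, hpS, hqS, ← add_mul, hab, one_mul]

theorem F_eq_sSup_regObjective (lam : EuclideanSpace ℝ (Fin M)) :
    F lam = sSup (regObjective 0 (-1) 1 0 lam '' stdSimplex ℝ (Fin M)) := by
  have : (fun q : Fin M → ℝ => entropy q - ∑ j, lam j * q j) = regObjective 0 (-1) 1 0 lam := by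
    funext q
    have : ∀ j, output (-1) q j = -q j := fun j => by
      simp [output, Matrix.neg_apply, Matrix.one_apply]
    simp only [regObjective, this, Pi.zero_apply, zero_mul, Finset.sum_const_zero, one_mul,
      mul_neg, Finset.sum_neg_distrib]
    ring
  rw [F, this]

theorem smoothObjective_eq_regObjective (W : Matrix (Fin N) (Fin M) ℝ) (ν : ℝ)
    (lam : EuclideanSpace ℝ (Fin M)) : smoothObjective W ν lam =
      regObjective (fun i => -condEntropy W i) W ν (-(ν * Real.logb 2 N)) lam := by
  funext p
  simp only [smoothObjective, linObjective, regObjective, neg_mul, Finset.sum_neg_distrib]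
  ring

theorem Gsmooth_eq_sSup_regObjective (W : Matrix (Fin N) (Fin M) ℝ)
    (c : Option ((Fin N → ℝ) × ℝ)) (ν : ℝ) (lam : EuclideanSpace ℝ (Fin M)) :
    Gsmooth W c ν lam =
      sSup (regObjective (fun i => -condEntropy W i) W ν (-(ν * Real.logb 2 N)) lam ''
        feasible c) := by
  rw [Gsmooth, smoothObjective_eq_regObjective]

theorem smoothMaximizer_spec (W : Matrix (Fin N) (Fin M) ℝ) {c : Option ((Fin N → ℝ) × ℝ)}
    (hc : (feasible c).Nonempty) (ν : ℝ) (lam : EuclideanSpace ℝ (Fin M)) :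
    smoothMaximizer W c ν lam ∈ feasible c ∧
      IsMaxOn (smoothObjective W ν lam) (feasible c) (smoothMaximizer W c ν lam) := by
  refine Classical.epsilon_spec (p := fun p => p ∈ feasible c ∧
    IsMaxOn (smoothObjective W ν lam) (feasible c) p) ?_
  rw [smoothObjective_eq_regObjective]
  exact exists_isMaxOn_regObjective (isCompact_feasible c) hc lam

/-- Without cost constraint the smoothed maximizer is a Gibbs distribution. -/
theorem smoothMaximizer_none (hN : 0 < N) (W : Matrix (Fin N) (Fin M) ℝ) {ν : ℝ} (hν : 0 < ν)
    (lam : EuclideanSpace ℝ (Fin M)) : smoothMaximizer W none ν lam =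
      gibbs fun i => (∑ j, W i j * lam j + -condEntropy W i) * Real.log 2 / ν := by
  have hg := gibbs_mem hN fun i => (∑ j, W i j * lam j + -condEntropy W i) * Real.log 2 / ν
  have h := smoothMaximizer_spec W (c := none) ⟨_, hg⟩ ν lam
  rw [smoothObjective_eq_regObjective] at h
  exact isMaxOn_regObjective_unique (convex_stdSimplex ℝ _) subset_rfl hν hg
    (isMaxOn_gibbs hN hν lam) h.1 h.2

/-- The maximizer in the definition of `F`. -/
noncomputable def outputMaximizer (lam : EuclideanSpace ℝ (Fin M)) : Fin M → ℝ :=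
  gibbs fun j => -lam j * Real.log 2

theorem outputMaximizer_mem (hM : 0 < M) (lam : EuclideanSpace ℝ (Fin M)) :
    outputMaximizer lam ∈ stdSimplex ℝ (Fin M) := gibbs_mem hM _

theorem isMaxOn_outputMaximizer (hM : 0 < M) (lam : EuclideanSpace ℝ (Fin M)) :
    IsMaxOn (regObjective 0 (-1) 1 0 lam) (stdSimplex ℝ (Fin M)) (outputMaximizer lam) := by
  have h := isMaxOn_gibbs (a := 0) (V := -1) (b := 0) hM one_pos lam
  have e : (fun i => (∑ j, (-1 : Matrix (Fin M) (Fin M) ℝ) i j * lam j + (0 : Fin M → ℝ) i) *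
      Real.log 2 / 1) = fun j => -lam j * Real.log 2 := by
    funext i
    simp [Matrix.neg_apply, Matrix.one_apply]
  rwa [e] at h

theorem sum_abs_neg_one_le (i : Fin M) : ∑ j, |(-1 : Matrix (Fin M) (Fin M) ℝ) i j| ≤ 1 := by
  simp [Matrix.neg_apply, Matrix.one_apply, apply_ite abs]

theorem IsChannel.sum_abs_le {W : Matrix (Fin N) (Fin M) ℝ} (hW : IsChannel W) (i : Fin N) :
    ∑ j, |W i j| ≤ 1 := by
  rw [← hW.row_sum i]
  exact (Finset.sum_congr rfl fun j _ => abs_of_nonneg (hW.nonneg i j)).le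

theorem gradient_F (hM : 0 < M) (x : EuclideanSpace ℝ (Fin M)) :
    gradient F x = outputVec (-1) (outputMaximizer x) := by
  have h := hasGradientAt_sSup_regObjective (isCompact_stdSimplex ℝ (Fin M))
    (convex_stdSimplex ℝ _) subset_rfl one_pos sum_abs_neg_one_le (outputMaximizer_mem hM x)
    (isMaxOn_outputMaximizer hM x)
  simp only [← F_eq_sSup_regObjective] at h
  exact h.gradient

theorem gradient_Gsmooth {W : Matrix (Fin N) (Fin M) ℝ} (hW : IsChannel W)
    {c : Option ((Fin N → ℝ) × ℝ)} (hc : (feasible c).Nonempty) {ν : ℝ} (hν : 0 < ν)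
    (x : EuclideanSpace ℝ (Fin M)) :
    gradient (Gsmooth W c ν) x = outputVec W (smoothMaximizer W c ν x) := by
  obtain ⟨h1, h2⟩ := smoothMaximizer_spec W hc ν x
  rw [smoothObjective_eq_regObjective] at h2
  have h := hasGradientAt_sSup_regObjective (isCompact_feasible c) (convex_feasible c)
    (feasible_subset c) hν hW.sum_abs_le h1 h2
  simp only [← Gsmooth_eq_sSup_regObjective] at h
  exact h.gradient

theorem smoothGradient_apply (hM : 0 < M) {W : Matrix (Fin N) (Fin M) ℝ} (hW : IsChannel W)
    {c : Option ((Fin N → ℝ) × ℝ)} (hc : (feasible c).Nonempty) {ν : ℝ} (hν : 0 < ν)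
    (x : EuclideanSpace ℝ (Fin M)) (j : Fin M) :
    smoothGradient W c ν x j = output W (smoothMaximizer W c ν x) j - outputMaximizer x j := by
  rw [smoothGradient, gradient_F hM, gradient_Gsmooth hW hc hν]
  simp [output, Matrix.neg_apply, Matrix.one_apply]
  ring

theorem F_add_inner_le (hM : 0 < M) (x y : EuclideanSpace ℝ (Fin M)) :
    F x + inner ℝ (gradient F x) (y - x) ≤ F y := by
  have h := add_inner_le_sSup_regObjective (a := 0) (V := -1) (ν := 1) (b := 0)
    (isCompact_stdSimplex ℝ (Fin M)) (outputMaximizer_mem hM x) x y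
  rwa [gradient_F hM, F_eq_sSup_regObjective, F_eq_sSup_regObjective,
    sSup_image_eq_of_isMaxOn (outputMaximizer_mem hM x) (isMaxOn_outputMaximizer hM x)]

theorem F_le_add_inner (hM : 0 < M) (x y : EuclideanSpace ℝ (Fin M)) :
    F y ≤ F x + inner ℝ (gradient F x) (y - x) + 1 / 2 * ‖y - x‖ ^ 2 := by
  have h := sSup_regObjective_le (isCompact_stdSimplex ℝ (Fin M)) (convex_stdSimplex ℝ _)
    subset_rfl one_pos sum_abs_neg_one_le (outputMaximizer_mem hM x)
    (isMaxOn_outputMaximizer hM x) y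
  rw [gradient_F hM, F_eq_sSup_regObjective, F_eq_sSup_regObjective,
    sSup_image_eq_of_isMaxOn (outputMaximizer_mem hM x) (isMaxOn_outputMaximizer hM x)]
  simpa using h

theorem Gsmooth_eq_smoothObjective {W : Matrix (Fin N) (Fin M) ℝ}
    {c : Option ((Fin N → ℝ) × ℝ)} (hc : (feasible c).Nonempty) {ν : ℝ}
    (x : EuclideanSpace ℝ (Fin M)) :
    Gsmooth W c ν x = smoothObjective W ν x (smoothMaximizer W c ν x) :=
  sSup_image_eq_of_isMaxOn (smoothMaximizer_spec W hc ν x).1 (smoothMaximizer_spec W hc ν x).2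

/-- For fixed $p$ the objective is affine in $\lambda$. This identity is what recovers a primal
point from the linear models of the scheme. -/
theorem Gsmooth_add_inner_eq {W : Matrix (Fin N) (Fin M) ℝ} (hW : IsChannel W)
    {c : Option ((Fin N → ℝ) × ℝ)} (hc : (feasible c).Nonempty) {ν : ℝ} (hν : 0 < ν)
    (x y : EuclideanSpace ℝ (Fin M)) :
    Gsmooth W c ν x + inner ℝ (gradient (Gsmooth W c ν) x) (y - x) =
      smoothObjective W ν y (smoothMaximizer W c ν x) := by
  rw [Gsmooth_eq_smoothObjective hc, gradient_Gsmooth hW hc hν, smoothObjective_eq_regObjective,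
    smoothObjective_eq_regObjective, regObjective_add_inner]

theorem Gsmooth_add_inner_le {W : Matrix (Fin N) (Fin M) ℝ} (hW : IsChannel W)
    {c : Option ((Fin N → ℝ) × ℝ)} (hc : (feasible c).Nonempty) {ν : ℝ} (hν : 0 < ν)
    (x y : EuclideanSpace ℝ (Fin M)) :
    Gsmooth W c ν x + inner ℝ (gradient (Gsmooth W c ν) x) (y - x) ≤ Gsmooth W c ν y := by
  rw [Gsmooth_add_inner_eq hW hc hν, Gsmooth_eq_smoothObjective hc y]
  exact (smoothMaximizer_spec W hc ν y).2 (smoothMaximizer_spec W hc ν x).1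

theorem Gsmooth_le_add_inner {W : Matrix (Fin N) (Fin M) ℝ} (hW : IsChannel W)
    {c : Option ((Fin N → ℝ) × ℝ)} (hc : (feasible c).Nonempty) {ν : ℝ} (hν : 0 < ν)
    (x y : EuclideanSpace ℝ (Fin M)) :
    Gsmooth W c ν y ≤ Gsmooth W c ν x + inner ℝ (gradient (Gsmooth W c ν) x) (y - x) +
      1 / ν / 2 * ‖y - x‖ ^ 2 := by
  obtain ⟨h1, h2⟩ := smoothMaximizer_spec W hc ν x
  rw [smoothObjective_eq_regObjective] at h2
  have h := sSup_regObjective_le (isCompact_feasible c) (convex_feasible c)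
    (feasible_subset c) hν hW.sum_abs_le h1 h2 y
  rwa [gradient_Gsmooth hW hc hν, Gsmooth_eq_smoothObjective hc x,
    smoothObjective_eq_regObjective, Gsmooth_eq_sSup_regObjective]

theorem entropy_nonneg {d : ℕ} {p : Fin d → ℝ} (hp : p ∈ stdSimplex ℝ (Fin d)) :
    0 ≤ entropy p := by
  refine Finset.sum_nonneg fun i _ => ?_
  have h1 : p i ≤ 1 := hp.2 ▸ Finset.single_le_sum (fun k _ => hp.1 k) (Finset.mem_univ i)
  rw [neg_nonneg]
  exact mul_nonpos_of_nonneg_of_nonpos (hp.1 i)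
    (Real.logb_nonpos one_lt_two (hp.1 i) h1)

theorem smoothObjective_le_linObjective {W : Matrix (Fin N) (Fin M) ℝ} {ν : ℝ} (hν : 0 ≤ ν)
    {p : Fin N → ℝ} (hp : p ∈ stdSimplex ℝ (Fin N)) (lam : EuclideanSpace ℝ (Fin M)) :
    smoothObjective W ν lam p ≤ linObjective W lam p := by
  have := mul_le_mul_of_nonneg_left (entropy_le_logb hp) hν
  rw [smoothObjective]
  linarith

theorem continuous_linObjective (W : Matrix (Fin N) (Fin M) ℝ) (lam : EuclideanSpace ℝ (Fin M)) :
    Continuous (linObjective W lam) := by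
  unfold linObjective
  have := continuous_output W
  fun_prop

theorem linObjective_le_G (W : Matrix (Fin N) (Fin M) ℝ) {c : Option ((Fin N → ℝ) × ℝ)}
    (lam : EuclideanSpace ℝ (Fin M)) {p : Fin N → ℝ} (hp : p ∈ feasible c) :
    linObjective W lam p ≤ G W c lam :=
  le_csSup ((isCompact_feasible c).image (continuous_linObjective W lam)).bddAbove
    (Set.mem_image_of_mem _ hp)

theorem G_le_Gsmooth_add (W : Matrix (Fin N) (Fin M) ℝ) {c : Option ((Fin N → ℝ) × ℝ)}
    (hc : (feasible c).Nonempty) {ν : ℝ} (hν : 0 ≤ ν) (lam : EuclideanSpace ℝ (Fin M)) :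
    G W c lam ≤ Gsmooth W c ν lam + ν * Real.logb 2 N := by
  refine csSup_le (hc.image _) (Set.forall_mem_image.2 fun p hp => ?_)
  have h1 := (smoothMaximizer_spec W hc ν lam).2 hp
  have h1 : smoothObjective W ν lam p ≤ _ := h1
  rw [← Gsmooth_eq_smoothObjective hc, smoothObjective] at h1
  have := mul_nonneg hν (entropy_nonneg (feasible_subset c hp))
  linarith

/-! ### Mutual information and weak duality -/

section Duality

variable {W : Matrix (Fin N) (Fin M) ℝ} {p : Fin N → ℝ} {γ : ℝ}

theorem IsChannel.output_mem (hW : IsChannel W) (hp : p ∈ stdSimplex ℝ (Fin N)) :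
    output W p ∈ stdSimplex ℝ (Fin M) := by
  refine ⟨fun j => Finset.sum_nonneg fun i _ => mul_nonneg (hW.nonneg i j) (hp.1 i), ?_⟩
  simp only [output]
  rw [Finset.sum_comm, ← hp.2]
  exact Finset.sum_congr rfl fun i _ => by rw [← Finset.sum_mul, hW.row_sum, one_mul]

theorem le_output (hγ : ∀ i j, γ ≤ W i j) (hp : p ∈ stdSimplex ℝ (Fin N)) (j : Fin M) :
    γ ≤ output W p j := by
  calc γ = ∑ i, γ * p i := by rw [← Finset.mul_sum, hp.2, mul_one]
    _ ≤ output W p j := Finset.sum_le_sum fun i _ => mul_le_mul_of_nonneg_right (hγ i j) (hp.1 i)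

theorem mutualInfo_eq (hpos : 0 < γ) (hγ : ∀ i j, γ ≤ W i j) (hp : p ∈ stdSimplex ℝ (Fin N)) :
    mutualInfo p W = -(∑ i, condEntropy W i * p i) + entropy (output W p) := by
  have e1 : entropy (output W p) = -∑ i, p i * ∑ j, W i j * Real.logb 2 (output W p j) := by
    rw [entropy, Finset.sum_neg_distrib]
    simp only [Finset.mul_sum]
    rw [Finset.sum_comm]
    congr 1
    refine Finset.sum_congr rfl fun j _ => ?_
    conv_lhs => rw [output, Finset.sum_mul]
    exact Finset.sum_congr rfl fun i _ => by rw [output]; ring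
  have e2 : -(∑ i, condEntropy W i * p i) = ∑ i, p i * ∑ j, W i j * Real.logb 2 (W i j) := by
    rw [← Finset.sum_neg_distrib]
    exact Finset.sum_congr rfl fun i _ => by rw [condEntropy]; ring
  rw [e1, e2, ← sub_eq_add_neg, ← Finset.sum_sub_distrib, mutualInfo]
  refine Finset.sum_congr rfl fun i _ => ?_
  rw [← mul_sub, ← Finset.sum_sub_distrib]
  congr 1
  refine Finset.sum_congr rfl fun j _ => ?_
  rw [Real.logb_div (hpos.trans_le (hγ i j)).ne' (hpos.trans_le (le_output hγ hp j)).ne']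
  ring

theorem entropy_sub_le_F (lam : EuclideanSpace ℝ (Fin M)) {q : Fin M → ℝ}
    (hq : q ∈ stdSimplex ℝ (Fin M)) : entropy q - ∑ j, lam j * q j ≤ F lam := by
  refine le_csSup ((isCompact_stdSimplex ℝ (Fin M)).image ?_).bddAbove
    (Set.mem_image_of_mem (fun q : Fin M → ℝ => entropy q - ∑ j, lam j * q j) hq)
  have := continuous_entropy (d := M)
  fun_prop

/-- Weak duality. -/
theorem mutualInfo_le_dual (hW : IsChannel W) (hpos : 0 < γ) (hγ : ∀ i j, γ ≤ W i j)
    {c : Option ((Fin N → ℝ) × ℝ)} (hp : p ∈ feasible c) (lam : EuclideanSpace ℝ (Fin M)) :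
    mutualInfo p W ≤ F lam + G W c lam := by
  have hpS := feasible_subset c hp
  have h1 := entropy_sub_le_F lam (hW.output_mem hpS)
  have h2 := linObjective_le_G W lam hp
  rw [mutualInfo_eq hpos hγ hpS]
  rw [linObjective] at h2
  linarith

/-- The multiplier `-log (Wᵀ p)`, which closes the duality gap of `p`. -/
noncomputable def outputMultiplier (W : Matrix (Fin N) (Fin M) ℝ) (p : Fin N → ℝ) :
    EuclideanSpace ℝ (Fin M) :=
  WithLp.toLp 2 fun j => -Real.logb 2 (output W p j)

/-- At this multiplier $F\le0$ by Gibbs' inequality, and $\lambda^\top W^\top p$ becomes the output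
entropy. -/
theorem F_add_linObjective_outputMultiplier_le (hW : IsChannel W) (hpos : 0 < γ)
    (hγ : ∀ i j, γ ≤ W i j) (hp : p ∈ stdSimplex ℝ (Fin N)) :
    F (outputMultiplier W p) + linObjective W (outputMultiplier W p) p ≤ mutualInfo p W := by
  have hq := hW.output_mem hp
  have h1 : F (outputMultiplier W p) ≤ 0 := by
    refine csSup_le (Set.Nonempty.image _ ⟨_, hq⟩) (Set.forall_mem_image.2 fun q' hq' => ?_)
    have := entropy_le_crossEntropy hq' hq fun j => hpos.trans_le (le_output hγ hp j)
    have e : ∑ j, outputMultiplier W p j * q' j = -∑ j, q' j * Real.logb 2 (output W p j) := by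
      rw [← Finset.sum_neg_distrib]
      exact Finset.sum_congr rfl fun j _ => by simp only [outputMultiplier]; ring
    change entropy q' - ∑ j, outputMultiplier W p j * q' j ≤ 0
    rw [e]
    linarith
  have h2 : linObjective W (outputMultiplier W p) p = mutualInfo p W := by
    rw [mutualInfo_eq hpos hγ hp, linObjective, entropy]
    congr 1
    exact Finset.sum_congr rfl fun j _ => by simp only [outputMultiplier]; ring
  linarith

/-- Every coordinate lies in $[0,\log(1/\gamma)]$. The factor $M$, rather than the $M^2$ in $D_1$,
is the slack that later pays for an arbitrary starting point. -/
theorem norm_sq_outputMultiplier_le (hW : IsChannel W) (hpos : 0 < γ)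
    (hγ : ∀ i j, γ ≤ W i j) (hp : p ∈ stdSimplex ℝ (Fin N)) :
    ‖outputMultiplier W p‖ ^ 2 ≤ M * Real.logb 2 γ⁻¹ ^ 2 := by
  have hq := hW.output_mem hp
  rw [EuclideanSpace.norm_sq_eq]
  have : (M : ℝ) * Real.logb 2 γ⁻¹ ^ 2 = ∑ _j : Fin M, Real.logb 2 γ⁻¹ ^ 2 := by simp
  rw [this]
  refine Finset.sum_le_sum fun j _ => ?_
  have h1 : output W p j ≤ 1 :=
    hq.2 ▸ Finset.single_le_sum (fun k _ => hq.1 k) (Finset.mem_univ j)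
  have h2 := le_output hγ hp j
  have h3 : Real.logb 2 (output W p j) ≤ 0 := Real.logb_nonpos one_lt_two (hq.1 j) h1
  have h4 : Real.logb 2 γ ≤ Real.logb 2 (output W p j) :=
    Real.logb_le_logb_of_le one_lt_two hpos h2
  have e : ‖outputMultiplier W p j‖ = -Real.logb 2 (output W p j) := by
    simp only [outputMultiplier, norm_neg, Real.norm_eq_abs]
    exact abs_of_nonpos h3
  rw [e, Real.logb_inv]
  exact pow_le_pow_left₀ (by linarith) (by linarith) 2

end Duality

/-! ### The duality gap of the output -/

theorem D₁_pos (M : ℕ) (γ : ℝ) : 0 < D₁ M γ := by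
  have : 0 < 1 / Real.log 2 := one_div_pos.2 (Real.log_pos one_lt_two)
  have : 0 < max (M * Real.logb 2 γ⁻¹) (1 / Real.log 2) := lt_max_of_lt_right this
  unfold D₁
  positivity

theorem one_le_D₂ (hN : 2 ≤ N) : 1 ≤ D₂ N := by
  have h : Real.logb 2 2 ≤ Real.logb 2 N :=
    Real.logb_le_logb_of_le one_lt_two two_pos (by exact_mod_cast hN)
  rwa [Real.logb_self_eq_one one_lt_two] at h

theorem smoothing_pos (hN : 2 ≤ N) (M : ℕ) (γ : ℝ) (n : ℕ) : 0 < smoothing N M γ n := by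
  have h1 := D₁_pos M γ
  have h2 : 0 < D₂ N := one_pos.trans_le (one_le_D₂ hN)
  unfold smoothing
  positivity

theorem radius_pos (hM : 0 < M) (γ : ℝ) : 0 < radius M γ := by
  have : 0 < 1 / Real.log 2 := one_div_pos.2 (Real.log_pos one_lt_two)
  have : 0 < max (Real.logb 2 γ⁻¹) (1 / Real.log 2) := lt_max_of_lt_right this
  unfold radius
  positivity

theorem IsChannel.output_pos {W : Matrix (Fin N) (Fin M) ℝ} (hW : IsChannel W) (hN : 0 < N) :
    0 < M := by
  rcases Nat.eq_zero_or_pos M with rfl | h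
  · simpa using hW.row_sum ⟨0, hN⟩
  · exact h

theorem sum_weights (n : ℕ) : ∑ k ∈ Finset.range (n + 1), ((k : ℝ) + 1) / 2 =
    ((n : ℝ) + 1) * (n + 2) / 4 := by
  induction n with
  | zero => norm_num
  | succ n ih => rw [Finset.sum_range_succ, ih]; push_cast; ring

theorem weight_eq (n k : ℕ) : 2 * ((k : ℝ) + 1) / (((n : ℝ) + 1) * ((n : ℝ) + 2)) =
    (((n : ℝ) + 1) * (n + 2) / 4)⁻¹ * (((k : ℝ) + 1) / 2) := by
  field_simp
  ring

theorem pHat_mem_feasible (W : Matrix (Fin N) (Fin M) ℝ) {c : Option ((Fin N → ℝ) × ℝ)}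
    (hc : (feasible c).Nonempty) (γ : ℝ) (x₀ : EuclideanSpace ℝ (Fin M)) (n : ℕ) :
    pHat W c γ x₀ n ∈ feasible c := by
  refine (convex_feasible c).sum_mem (fun k _ => by positivity) ?_
    fun k _ => (smoothMaximizer_spec W hc _ _).1
  simp only [weight_eq, ← Finset.mul_sum, sum_weights]
  exact inv_mul_cancel₀ (by positivity)

theorem linObjective_eq_sum (W : Matrix (Fin N) (Fin M) ℝ) (lam : EuclideanSpace ℝ (Fin M))
    (p : Fin N → ℝ) :
    linObjective W lam p = ∑ i, (-condEntropy W i + ∑ j, lam j * W i j) * p i := by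
  have : ∑ j, lam j * output W p j = ∑ i, (∑ j, lam j * W i j) * p i := by
    simp only [output, Finset.mul_sum, Finset.sum_mul]
    rw [Finset.sum_comm]
    exact Finset.sum_congr rfl fun i _ => Finset.sum_congr rfl fun j _ => by ring
  rw [linObjective, this, ← Finset.sum_neg_distrib, ← Finset.sum_add_distrib]
  exact Finset.sum_congr rfl fun i _ => by ring

theorem linObjective_sum_smul (W : Matrix (Fin N) (Fin M) ℝ) (lam : EuclideanSpace ℝ (Fin M))
    {ι : Type*} (s : Finset ι) (w : ι → ℝ) (p : ι → Fin N → ℝ) :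
    linObjective W lam (∑ k ∈ s, w k • p k) = ∑ k ∈ s, w k * linObjective W lam (p k) := by
  simp only [linObjective_eq_sum, Finset.sum_apply, Pi.smul_apply, smul_eq_mul, Finset.mul_sum]
  rw [Finset.sum_comm]
  exact Finset.sum_congr rfl fun k _ => Finset.sum_congr rfl fun i _ => by ring

/-- The gradient is a difference of two probability vectors, and $(a_j-b_j)^2\le a_j+b_j$. -/
theorem norm_sq_smoothGradient_le (hM : 0 < M) {W : Matrix (Fin N) (Fin M) ℝ} (hW : IsChannel W)
    {c : Option ((Fin N → ℝ) × ℝ)} (hc : (feasible c).Nonempty) {ν : ℝ} (hν : 0 < ν)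
    (x : EuclideanSpace ℝ (Fin M)) : ‖smoothGradient W c ν x‖ ^ 2 ≤ 2 := by
  have ha := hW.output_mem (feasible_subset c (smoothMaximizer_spec W hc ν x).1)
  have hb := outputMaximizer_mem hM x
  rw [EuclideanSpace.norm_sq_eq]
  simp only [smoothGradient_apply hM hW hc hν, Real.norm_eq_abs, sq_abs]
  set a := output W (smoothMaximizer W c ν x)
  set b := outputMaximizer x
  have le_one : ∀ q ∈ stdSimplex ℝ (Fin M), ∀ j, q j ≤ 1 := fun q hq j =>
    hq.2 ▸ Finset.single_le_sum (fun k _ => hq.1 k) (Finset.mem_univ j)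
  calc ∑ j, (a j - b j) ^ 2 ≤ ∑ j, (a j + b j) := by
        refine Finset.sum_le_sum fun j _ => ?_
        have := mul_nonneg (ha.1 j) (hb.1 j)
        have := mul_le_mul_of_nonneg_left (le_one a ha j) (ha.1 j)
        have := mul_le_mul_of_nonneg_left (le_one b hb j) (hb.1 j)
        nlinarith
    _ = 2 := by rw [Finset.sum_add_distrib, ha.2, hb.2]; norm_num

/-- The primal-dual estimate behind the gap bound, with the error `e` of the starting point. -/
theorem dualSmooth_le (hN : 2 ≤ N) {W : Matrix (Fin N) (Fin M) ℝ} {γ : ℝ} (hW : IsChannel W)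
    {c : Option ((Fin N → ℝ) × ℝ)} (hc : (feasible c).Nonempty) (n : ℕ)
    {x₀ u : EuclideanSpace ℝ (Fin M)} (hx₀ : x₀ ∈ Q M γ) (hu : u ∈ Q M γ) :
    ((n : ℝ) + 1) * (n + 2) / 4 * (F (lamHat W c γ x₀ n) +
        Gsmooth W c (smoothing N M γ n) (lamHat W c γ x₀ n)) ≤
      ((n : ℝ) + 1) * (n + 2) / 4 * (F u + linObjective W u (pHat W c γ x₀ n)) +
        (1 + 1 / smoothing N M γ n) / 2 * ‖u‖ ^ 2 + (71 / 100 * radius M γ + 1 / 4) := by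
  have hM := hW.output_pos (by omega)
  have hν := smoothing_pos hN M γ n
  set ν := smoothing N M γ n with hνdef
  have hL : 1 ≤ 1 + 1 / ν := by have : 0 < 1 / ν := by positivity
                                linarith
  have hR := (radius_pos hM γ).le
  set g := smoothGradient W c ν with hg
  set L := 1 + 1 / ν with hLdef
  have hgx : ∀ x y, inner ℝ (g x) (y - x) =
      inner ℝ (gradient F x) (y - x) + inner ℝ (gradient (Gsmooth W c ν) x) (y - x) :=
    fun x y => inner_add_left _ _ _
  have hmain := fastGradient_le (f := fun x => F x + Gsmooth W c ν x) (g := g) (L := L)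
    (R := radius M γ) (x₀ := x₀) (e := 71 / 100 * radius M γ + 1 / 4) hR (by linarith) hx₀
    (fun x y => by
      have h1 := F_add_inner_le hM x y
      have h2 := Gsmooth_add_inner_le hW hc hν x y
      simp only [hgx]
      linarith)
    (fun x y => by
      have h1 := F_le_add_inner hM x y
      have h2 := Gsmooth_le_add_inner hW hc hν x y
      simp only [hgx, hLdef]
      have : (1 + 1 / ν) / 2 * ‖y - x‖ ^ 2 =
        1 / 2 * ‖y - x‖ ^ 2 + 1 / ν / 2 * ‖y - x‖ ^ 2 := by ring
      linarith)
    (by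
      have h1 := norm_sq_smoothGradient_le hM hW hc hν x₀
      rw [← hg] at h1
      -- $\sqrt2\le1.42$, half of which is the $71/100$; the $1/4$ is $2/(8L)$ with $L\ge1$.
      have h2 : ‖g x₀‖ ≤ 142 / 100 := by
        refine abs_le_of_sq_le_sq' ?_ (by norm_num) |>.2
        linarith
      have h3 : ‖g x₀‖ * radius M γ ≤ 142 / 100 * radius M γ :=
        mul_le_mul_of_nonneg_right h2 hR
      have h4 : ‖g x₀‖ ^ 2 / (8 * L) ≤ 1 / 4 := by
        rw [div_le_div_iff₀ (by linarith) (by norm_num)]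
        linarith
      linarith) n hu
  refine hmain.trans ?_
  have hest : ∑ i ∈ Finset.range (n + 1), ((i : ℝ) + 1) / 2 *
      ((F (schemeX g L (radius M γ) x₀ i) + Gsmooth W c ν (schemeX g L (radius M γ) x₀ i)) +
        inner ℝ (g (schemeX g L (radius M γ) x₀ i)) (u - schemeX g L (radius M γ) x₀ i)) ≤
      ((n : ℝ) + 1) * (n + 2) / 4 * (F u + linObjective W u (pHat W c γ x₀ n)) := by
    have e1 : ((n : ℝ) + 1) * (n + 2) / 4 * linObjective W u (pHat W c γ x₀ n) =
        ∑ i ∈ Finset.range (n + 1), ((i : ℝ) + 1) / 2 *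
          linObjective W u (smoothMaximizer W c ν (schemeX g L (radius M γ) x₀ i)) := by
      rw [pHat, linObjective_sum_smul, Finset.mul_sum]
      refine Finset.sum_congr rfl fun k _ => ?_
      rw [weight_eq, ← mul_assoc, ← mul_assoc, mul_inv_cancel₀ (by positivity), one_mul]
      rfl
    rw [mul_add, e1, ← sum_weights, Finset.sum_mul, ← Finset.sum_add_distrib]
    refine Finset.sum_le_sum fun i _ => ?_
    rw [← mul_add]
    refine mul_le_mul_of_nonneg_left ?_ (by positivity)
    set x := schemeX g L (radius M γ) x₀ i
    have h1 := F_add_inner_le hM x u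
    have h2 := Gsmooth_add_inner_eq hW hc hν x u
    have h3 := smoothObjective_le_linObjective (W := W) hν.le
      (feasible_subset c (smoothMaximizer_spec W hc ν x).1) u
    rw [hgx]
    linarith
  rw [estimate]
  linarith

/-- Used with $K=M\log(1/\gamma)$ and $m=n+1$: prox term of $u$ plus starting error against the
permitted $LD_1(m+1)/m$. Here $1.19K$ dominates $0.71R+1/4$, since $R\le\frac32K$ and $K\ge2$. The
growth of $L$ with $m$ is needed, because for small $K$ and large $m$ the slack $K^2/4$ alone is too
small. -/
theorem start_error_le {K L m : ℝ} (hK : 2 ≤ K) (hm : 1 ≤ m) (hL : 1 + 7 / 10 * m / K ≤ L) :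
    L * (K ^ 2 / 4) + 119 / 100 * K ≤ L * (K ^ 2 / 2) * ((m + 1) / m) := by
  have h1 : (1 + 7 / 10 * m / K) * (K ^ 2 / 4 + K ^ 2 / (2 * m)) ≤
      L * (K ^ 2 / 4 + K ^ 2 / (2 * m)) :=
    mul_le_mul_of_nonneg_right hL (by positivity)
  have e1 : (1 + 7 / 10 * m / K) * (K ^ 2 / 4 + K ^ 2 / (2 * m)) =
      K * (K / 4 + K / 2 * (1 / m) + 7 / 40 * m + 7 / 20) := by
    field_simp
    ring
  have e2 : L * (K ^ 2 / 2) * ((m + 1) / m) =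
      L * (K ^ 2 / 4) + L * (K ^ 2 / 4 + K ^ 2 / (2 * m)) := by
    field_simp
    ring
  have h2 : 1 / 2 ≤ 1 / m + 7 / 40 * m := by
    have : 1 / m + 7 / 40 * m - 1 / 2 = (1 + 7 / 40 * m ^ 2 - m / 2) / m := by field_simp
    have h : 0 ≤ (1 + 7 / 40 * m ^ 2 - m / 2) / m :=
      div_nonneg (by nlinarith [sq_nonneg (m - 10 / 7)]) (by linarith)
    linarith
  have h3 : 1 / m ≤ K / 2 * (1 / m) := le_mul_of_one_le_left (by positivity) (by linarith)
  have h4 : K * (119 / 100) ≤ K * (K / 4 + K / 2 * (1 / m) + 7 / 40 * m + 7 / 20) :=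
    mul_le_mul_of_nonneg_left (by linarith) (by linarith)
  rw [e1] at h1
  rw [e2]
  linarith

theorem log_two_inv_le : 1 / Real.log 2 ≤ 3 / 2 := by
  rw [div_le_div_iff₀ (Real.log_pos one_lt_two) two_pos]
  linarith [Real.log_two_gt_d9]

/-- A row sum is at least $M\gamma$, so $\gamma\le1/2$. -/
theorem one_le_logb_inv (hN : 0 < N) (hM : 2 ≤ M) {W : Matrix (Fin N) (Fin M) ℝ} {γ : ℝ}
    (hW : IsChannel W) (hpos : 0 < γ) (hγ : ∀ i j, γ ≤ W i j) : 1 ≤ Real.logb 2 γ⁻¹ := by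
  have h1 : (M : ℝ) * γ ≤ 1 := by
    rw [← hW.row_sum ⟨0, hN⟩]
    calc (M : ℝ) * γ = ∑ _j : Fin M, γ := by simp
      _ ≤ _ := Finset.sum_le_sum fun j _ => hγ _ j
  have h2 : (2 : ℝ) ≤ γ⁻¹ := by
    rw [le_inv_comm₀ two_pos hpos, le_inv_comm₀ hpos two_pos]
    have : (2 : ℝ) ≤ M := by exact_mod_cast hM
    rw [le_inv_comm₀ two_pos hpos, inv_eq_one_div, le_div_iff₀ two_pos]
    nlinarith
  have h3 := Real.logb_le_logb_of_le one_lt_two two_pos h2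
  rwa [Real.logb_self_eq_one one_lt_two] at h3

theorem smoothing_mul_D₂ (hN : 2 ≤ N) (M : ℕ) (γ : ℝ) (n : ℕ) :
    smoothing N M γ n * D₂ N = 2 / ((n : ℝ) + 1) * √(D₁ M γ * D₂ N) := by
  have h2 : 0 < D₂ N := one_pos.trans_le (one_le_D₂ hN)
  have h : √(D₁ M γ / D₂ N) * D₂ N = √(D₁ M γ * D₂ N) := by
    rw [Real.sqrt_div (D₁_pos M γ).le, Real.sqrt_mul (D₁_pos M γ).le]
    have : 0 < √(D₂ N) := Real.sqrt_pos.2 h2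
    field_simp
    rw [Real.sq_sqrt h2.le]
  rw [smoothing, mul_assoc, h]

theorem D₁_div_smoothing (hN : 2 ≤ N) (M : ℕ) (γ : ℝ) (n : ℕ) :
    D₁ M γ / smoothing N M γ n = ((n : ℝ) + 1) / 2 * √(D₁ M γ * D₂ N) := by
  have h2 : 0 < D₂ N := one_pos.trans_le (one_le_D₂ hN)
  have h1 := D₁_pos M γ
  rw [div_eq_iff (smoothing_pos hN M γ n).ne', smoothing]
  have h : √(D₁ M γ * D₂ N) * √(D₁ M γ / D₂ N) = D₁ M γ := by
    rw [← Real.sqrt_mul (by positivity), show D₁ M γ * D₂ N * (D₁ M γ / D₂ N) = D₁ M γ ^ 2 by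
      field_simp, Real.sqrt_sq h1.le]
  have e : ((n : ℝ) + 1) / 2 * √(D₁ M γ * D₂ N) * (2 / ((n : ℝ) + 1) * √(D₁ M γ / D₂ N)) =
      √(D₁ M γ * D₂ N) * √(D₁ M γ / D₂ N) := by field_simp
  rw [e, h]

theorem smoothing_le (hN : 2 ≤ N) (M : ℕ) (γ : ℝ) (n : ℕ) :
    smoothing N M γ n ≤ 2 / ((n : ℝ) + 1) * √(D₁ M γ) := by
  unfold smoothing
  gcongr
  exact div_le_self (D₁_pos M γ).le (one_le_D₂ hN)

theorem gap_le_of_two_le (hN : 2 ≤ N) (hM : 2 ≤ M) {W : Matrix (Fin N) (Fin M) ℝ} {γ : ℝ}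
    (hW : IsChannel W) (hpos : 0 < γ) (hγ : ∀ i j, γ ≤ W i j) {c : Option ((Fin N → ℝ) × ℝ)}
    (hc : (feasible c).Nonempty) (n : ℕ) {x₀ : EuclideanSpace ℝ (Fin M)} (hx₀ : x₀ ∈ Q M γ) :
    F (lamHat W c γ x₀ n) + G W c (lamHat W c γ x₀ n) - mutualInfo (pHat W c γ x₀ n) W ≤
      4 / ((n : ℝ) + 1) * √(D₁ M γ * D₂ N) + 4 * D₁ M γ / ((n : ℝ) + 1) ^ 2 := by
  set l := Real.logb 2 γ⁻¹ with hl
  have hl1 : 1 ≤ l := one_le_logb_inv (by omega) hM hW hpos hγ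
  have hM2 : (2 : ℝ) ≤ M := by exact_mod_cast hM
  set K := (M : ℝ) * l with hK
  have hK2 : 2 ≤ K := by nlinarith
  have hlog := log_two_inv_le
  have hD1 : D₁ M γ = K ^ 2 / 2 := by
    rw [D₁, ← hl, ← hK, max_eq_left (by linarith)]; ring
  have hRlo : K ≤ radius M γ :=
    mul_le_mul_of_nonneg_left (le_max_left _ _) (by linarith)
  have hRup : radius M γ ≤ 3 / 2 * K := by
    have : max l (1 / Real.log 2) ≤ 3 / 2 * l := max_le (by linarith) (by linarith)
    have := mul_le_mul_of_nonneg_left this (by linarith : (0 : ℝ) ≤ M)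
    calc radius M γ ≤ M * (3 / 2 * l) := this
      _ = 3 / 2 * K := by rw [hK]; ring
  have hp := pHat_mem_feasible W hc γ x₀ n
  have hpS := feasible_subset c hp
  set u := outputMultiplier W (pHat W c γ x₀ n)
  have hu2 : ‖u‖ ^ 2 ≤ M * l ^ 2 := norm_sq_outputMultiplier_le hW hpos hγ hpS
  -- This is where $M\ge2$ halves the prox term.
  have hu3 : ‖u‖ ^ 2 ≤ K ^ 2 / 2 := by
    have : (M : ℝ) * l ^ 2 * 2 ≤ (M : ℝ) * l ^ 2 * M :=
      mul_le_mul_of_nonneg_left hM2 (by positivity)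
    have e : K ^ 2 = (M : ℝ) * l ^ 2 * M := by rw [hK]; ring
    linarith
  have hu : u ∈ Q M γ := by
    have : ‖u‖ ≤ K := abs_le_of_sq_le_sq' (by nlinarith) (by linarith) |>.2
    exact this.trans hRlo
  have hmain := dualSmooth_le hN hW hc n hx₀ hu
  have hdual := F_add_linObjective_outputMultiplier_le hW hpos hγ hpS
  have hν := smoothing_pos hN M γ n
  have hG := G_le_Gsmooth_add W hc hν.le (lamHat W c γ x₀ n)
  have e1 := smoothing_mul_D₂ hN M γ n
  have e2 := D₁_div_smoothing hN M γ n
  have h5 := smoothing_le hN M γ n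
  rw [← D₂, e1] at hG
  set ν := smoothing N M γ n
  set T := √(D₁ M γ * D₂ N)
  set m : ℝ := (n : ℝ) + 1 with hm
  have hm1 : 1 ≤ m := by rw [hm]; linarith [n.cast_nonneg (α := ℝ)]
  have hn2 : (n : ℝ) + 2 = m + 1 := by rw [hm]; ring
  rw [hn2] at hmain
  -- $\sqrt{D_1}=K/\sqrt2\le0.71K$ and $D_2\ge1$ give $\nu\le1.42K/m$, and $0.7\cdot1.42=0.994$.
  have hνinv : 7 / 10 * m / K ≤ 1 / ν := by
    have h6 : √(D₁ M γ) ≤ 71 / 100 * K := by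
      rw [hD1]
      refine Real.sqrt_le_iff.2 ⟨by positivity, ?_⟩
      nlinarith
    have h7 : 0 < 2 / m := by positivity
    have h8 : ν ≤ 2 / m * (71 / 100 * K) := h5.trans (mul_le_mul_of_nonneg_left h6 h7.le)
    rw [div_le_div_iff₀ (by linarith) hν, one_mul]
    calc 7 / 10 * m * ν ≤ 7 / 10 * m * (2 / m * (71 / 100 * K)) := by gcongr
      _ = 994 / 1000 * K := by field_simp; ring
      _ ≤ K := by linarith
  have herr := start_error_le (L := 1 + 1 / ν) hK2 hm1 (by linarith)
  set L := 1 + 1 / ν with hL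
  have hL0 : 0 ≤ L := by positivity
  have h6 : L / 2 * ‖u‖ ^ 2 ≤ L * (K ^ 2 / 4) := by
    have := mul_le_mul_of_nonneg_left hu3 (by positivity : 0 ≤ L / 2)
    linarith
  have h7 : m * (m + 1) / 4 * (F (lamHat W c γ x₀ n) + Gsmooth W c ν (lamHat W c γ x₀ n)) ≤
      m * (m + 1) / 4 * (mutualInfo (pHat W c γ x₀ n) W + 4 * (L * D₁ M γ) / m ^ 2) := by
    have e3 : m * (m + 1) / 4 * (mutualInfo (pHat W c γ x₀ n) W + 4 * (L * D₁ M γ) / m ^ 2) =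
        m * (m + 1) / 4 * mutualInfo (pHat W c γ x₀ n) W + L * (K ^ 2 / 2) * ((m + 1) / m) := by
      rw [hD1]; field_simp
    have h8 := mul_le_mul_of_nonneg_left hdual (by positivity : 0 ≤ m * (m + 1) / 4)
    rw [e3]
    linarith
  have h8 := le_of_mul_le_mul_left h7 (by positivity)
  -- The second summand equals $\nu D_2$, the error of smoothing $G$; together they form $\frac4mT$.
  have e4 : 4 * (L * D₁ M γ) / m ^ 2 = 4 * D₁ M γ / m ^ 2 + 2 / m * T := by
    have : L * D₁ M γ = D₁ M γ + m / 2 * T := by rw [← e2, hL]; ring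
    rw [this]
    field_simp
    ring
  have e5 : 4 / m * T = 2 / m * T + 2 / m * T := by ring
  rw [e4] at h8
  linarith

/-- With one output letter every entry of $W$ is 1, so $F(\lambda)\le-\lambda$,
$G(\lambda)\le\lambda$ and the information is zero. -/
theorem gap_nonpos_of_one {W : Matrix (Fin N) (Fin 1) ℝ} (hW : IsChannel W)
    {c : Option ((Fin N → ℝ) × ℝ)} (hc : (feasible c).Nonempty) {p : Fin N → ℝ}
    (hp : p ∈ stdSimplex ℝ (Fin N)) (lam : EuclideanSpace ℝ (Fin 1)) :
    F lam + G W c lam - mutualInfo p W ≤ 0 := by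
  have hW1 : ∀ i, W i 0 = 1 := fun i => by simpa using hW.row_sum i
  have hout : ∀ q ∈ stdSimplex ℝ (Fin N), output W q 0 = 1 := fun q hq => by
    simpa [output, hW1] using hq.2
  have h1 : F lam ≤ -lam 0 := by
    refine csSup_le (Set.Nonempty.image _ ⟨_, hW.output_mem hp⟩)
      (Set.forall_mem_image.2 fun q hq => ?_)
    have h := entropy_le_logb hq
    have hq1 : q 0 = 1 := by simpa using hq.2
    simp only [Nat.cast_one, Real.logb_one] at h
    simpa [hq1] using h
  have h2 : G W c lam ≤ lam 0 := by
    refine csSup_le (hc.image _) (Set.forall_mem_image.2 fun q hq => ?_)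
    simp [linObjective, condEntropy, hW1, hout q (feasible_subset c hq)]
  have h3 : mutualInfo p W = 0 := by
    simp [mutualInfo, hW1, hout p hp]
  linarith

theorem gap_le (hN : 2 ≤ N) {W : Matrix (Fin N) (Fin M) ℝ} {γ : ℝ}
    (hW : IsChannel W) (hpos : 0 < γ) (hγ : ∀ i j, γ ≤ W i j) {c : Option ((Fin N → ℝ) × ℝ)}
    (hc : (feasible c).Nonempty) (n : ℕ) {x₀ : EuclideanSpace ℝ (Fin M)} (hx₀ : x₀ ∈ Q M γ) :
    F (lamHat W c γ x₀ n) + G W c (lamHat W c γ x₀ n) - mutualInfo (pHat W c γ x₀ n) W ≤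
      4 / ((n : ℝ) + 1) * √(D₁ M γ * D₂ N) + 4 * D₁ M γ / ((n : ℝ) + 1) ^ 2 := by
  have hM := hW.output_pos (by omega)
  rcases (show M = 1 ∨ 2 ≤ M by omega) with rfl | hM2
  · have := D₁_pos 1 γ
    exact (gap_nonpos_of_one hW hc (feasible_subset c (pHat_mem_feasible W hc γ x₀ n)) _).trans
      (by positivity)
  · exact gap_le_of_two_le hN hM2 hW hpos hγ hc n hx₀

/-- With $\alpha=4\sqrt{D_1D_2}/\varepsilon$ and $\beta=2\sqrt{D_1/\varepsilon}$, $m\ge\alpha+\beta$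
gives $m^2\ge\alpha m+\beta m\ge\alpha m+\beta^2$. -/
theorem error_le_of_iterationBound_le {γ ε m : ℝ} (hN : 2 ≤ N) (hε : 0 < ε)
    (hm : iterationBound N M γ ε ≤ m) :
    4 / m * √(D₁ M γ * D₂ N) + 4 * D₁ M γ / m ^ 2 ≤ ε := by
  have h1 := D₁_pos M γ
  have h2 : 0 < D₂ N := one_pos.trans_le (one_le_D₂ hN)
  have hT : 0 < √(D₁ M γ * D₂ N) := Real.sqrt_pos.2 (mul_pos h1 h2)
  have hB : 0 < √(D₁ M γ / ε) := Real.sqrt_pos.2 (div_pos h1 hε)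
  have hBsq : √(D₁ M γ / ε) ^ 2 * ε = D₁ M γ := by
    rw [Real.sq_sqrt (div_pos h1 hε).le, div_mul_cancel₀ _ hε.ne']
  set T := √(D₁ M γ * D₂ N)
  set B := √(D₁ M γ / ε)
  rw [iterationBound] at hm
  have hα : 0 < 4 * T * (1 / ε) := by positivity
  have hm0 : 0 < m := by linarith
  rw [← hBsq]
  have e : 4 / m * T + 4 * (B ^ 2 * ε) / m ^ 2 =
      ε * ((4 * T * (1 / ε) * m + (2 * B) ^ 2) / m ^ 2) := by field_simp; ring
  rw [e]
  refine mul_le_of_le_one_right hε.le ((div_le_one (by positivity)).2 ?_)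
  nlinarith

/-! ### The capacity problems -/

section Capacity

variable {W : Matrix (Fin N) (Fin M) ℝ} {γ : ℝ}

theorem continuousOn_mutualInfo (hpos : 0 < γ) (hγ : ∀ i j, γ ≤ W i j) :
    ContinuousOn (fun p => mutualInfo p W) (stdSimplex ℝ (Fin N)) := by
  have h : Continuous fun p : Fin N → ℝ =>
      -(∑ i, condEntropy W i * p i) + entropy (output W p) := by
    have := continuous_entropy (d := M)
    have : Continuous fun p => output W p := continuous_pi (continuous_output W)
    fun_prop
  exact h.continuousOn.congr fun p hp => mutualInfo_eq hpos hγ hp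

theorem mutualInfo_concave (hW : IsChannel W) (hpos : 0 < γ) (hγ : ∀ i j, γ ≤ W i j)
    {p q : Fin N → ℝ} (hp : p ∈ stdSimplex ℝ (Fin N)) (hq : q ∈ stdSimplex ℝ (Fin N)) {s t : ℝ}
    (hs : 0 < s) (ht : 0 < t) (hst : s + t = 1) :
    s * mutualInfo p W + t * mutualInfo q W ≤ mutualInfo (s • p + t • q) W := by
  rw [mutualInfo_eq hpos hγ hp, mutualInfo_eq hpos hγ hq,
    mutualInfo_eq hpos hγ (convex_stdSimplex ℝ _ hp hq hs.le ht.le hst), sum_mul_smul_add]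
  have e : output W (s • p + t • q) = s • output W p + t • output W q :=
    funext fun j => output_smul_add W p q s t j
  rw [e]
  have := entropy_concave (hW.output_mem hp) (hW.output_mem hq) hs ht hst
  linarith

/-- The threshold cost is attained by an optimal input distribution. -/
theorem exists_costThreshold (hN : 0 < N) (hpos : 0 < γ) (hγ : ∀ i j, γ ≤ W i j)
    (s : Fin N → ℝ) : ∃ p ∈ stdSimplex ℝ (Fin N),
      (∀ p' ∈ stdSimplex ℝ (Fin N), mutualInfo p' W ≤ mutualInfo p W) ∧
        ∑ i, s i * p i = costThreshold W s := by
  have hne : (stdSimplex ℝ (Fin N)).Nonempty := ⟨_, gibbs_mem hN 0⟩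
  have hcont := continuousOn_mutualInfo hpos hγ
  obtain ⟨p₀, hp₀, hmax⟩ := (isCompact_stdSimplex ℝ (Fin N)).exists_isMaxOn hne hcont
  set A := {p | p ∈ stdSimplex ℝ (Fin N) ∧
    ∀ p' ∈ stdSimplex ℝ (Fin N), mutualInfo p' W ≤ mutualInfo p W} with hA
  -- The maximizers form a superlevel set of a continuous function, hence a compact set.
  have hAe : A = stdSimplex ℝ (Fin N) ∩ (fun p => mutualInfo p W) ⁻¹' Set.Ici (mutualInfo p₀ W) := by
    ext p
    exact ⟨fun h => ⟨h.1, h.2 p₀ hp₀⟩, fun h => ⟨h.1, fun p' hp' => (hmax hp').trans h.2⟩⟩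
  have hAc : IsCompact A := by
    rw [hAe]
    exact (isCompact_stdSimplex ℝ (Fin N)).of_isClosed_subset
      (hcont.preimage_isClosed_of_isClosed (isClosed_stdSimplex ℝ (Fin N)) isClosed_Ici)
      Set.inter_subset_left
  have hs : Continuous fun p : Fin N → ℝ => ∑ i, s i * p i := by fun_prop
  obtain ⟨p, hp, hpe⟩ := (hAc.image hs).sInf_mem (Set.Nonempty.image _ ⟨p₀, hp₀, fun _ h => hmax h⟩)
  exact ⟨p, hp.1, hp.2, hpe⟩

/-- A capacity problem has the same value as its reformulation. -/
theorem isLUB_capacity (hN : 0 < N) (hW : IsChannel W) (hpos : 0 < γ) (hγ : ∀ i j, γ ≤ W i j)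
    {c : Option ((Fin N → ℝ) × ℝ)} (hc : (feasible c).Nonempty) {s : Fin N → ℝ} {S : ℝ}
    (hr : Reformulates W c s S) :
    IsLUB ((fun p => mutualInfo p W) '' feasible c) (capacity W s S) := by
  obtain ⟨p₀, hp₀, hmax, hcost⟩ := exists_costThreshold hN hpos hγ s
  set A := {p | p ∈ stdSimplex ℝ (Fin N) ∧ ∑ i, s i * p i ≤ S} with hA
  have hbdd : BddAbove ((fun p => mutualInfo p W) '' A) :=
    ⟨mutualInfo p₀ W, Set.forall_mem_image.2 fun p hp => hmax p hp.1⟩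
  rcases hr with ⟨hS, rfl⟩ | ⟨hS, rfl⟩
  · have hsub : feasible (some (s, S)) ⊆ A := fun p hp => ⟨hp.1, hp.2.le⟩
    -- Mix an input of cost below $S$ with the cheapest global optimum $p_0$, whose cost exceeds
    -- $S$, until the cost is $S$; by concavity the information does not drop.
    have key : ∀ p ∈ A, ∃ p' ∈ feasible (some (s, S)), mutualInfo p W ≤ mutualInfo p' W := by
      rintro p ⟨hp, hpS⟩
      rcases hpS.eq_or_lt with hpS | hpS
      · exact ⟨p, ⟨hp, hpS⟩, le_rfl⟩
      set a := ∑ i, s i * p i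
      set b := costThreshold W s
      have hab : 0 < b - a := by linarith
      have h1 : 0 < (b - S) / (b - a) := div_pos (by linarith) hab
      have h2 : 0 < (S - a) / (b - a) := div_pos (by linarith) hab
      have h12 : (b - S) / (b - a) + (S - a) / (b - a) = 1 := by field_simp; ring
      refine ⟨((b - S) / (b - a)) • p + ((S - a) / (b - a)) • p₀,
        ⟨convex_stdSimplex ℝ _ hp hp₀ h1.le h2.le h12, ?_⟩, ?_⟩
      · rw [sum_mul_smul_add, hcost]
        change (b - S) / (b - a) * a + (S - a) / (b - a) * b = S
        field_simp
        ring
      · refine le_trans ?_ (mutualInfo_concave hW hpos hγ hp hp₀ h1 h2 h12)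
        have := mul_le_mul_of_nonneg_left (hmax p hp) h2.le
        calc mutualInfo p W = (b - S) / (b - a) * mutualInfo p W +
              (S - a) / (b - a) * mutualInfo p W := by rw [← add_mul, h12, one_mul]
          _ ≤ _ := by linarith
    refine ⟨Set.forall_mem_image.2 fun p hp => le_csSup hbdd (Set.mem_image_of_mem _ (hsub hp)),
      fun B hB => csSup_le ((hc.mono hsub).image _) (Set.forall_mem_image.2 fun p hp => ?_)⟩
    obtain ⟨p', hp', hle⟩ := key p hp
    exact hle.trans (hB (Set.mem_image_of_mem _ hp'))
  · have hp₀A : p₀ ∈ A := ⟨hp₀, hcost.le.trans hS⟩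
    refine ⟨Set.forall_mem_image.2 fun p hp => (hmax p hp).trans
      (le_csSup hbdd (Set.mem_image_of_mem _ hp₀A)), fun B hB => ?_⟩
    exact csSup_le ⟨_, Set.mem_image_of_mem _ hp₀A⟩
      (Set.forall_mem_image.2 fun p hp => hB (Set.mem_image_of_mem _ hp.1))

theorem isEpsSolution_of_gap_le (hN : 0 < N) (hW : IsChannel W) (hpos : 0 < γ)
    (hγ : ∀ i j, γ ≤ W i j) {c : Option ((Fin N → ℝ) × ℝ)} {ε : ℝ}
    {lam : EuclideanSpace ℝ (Fin M)} {p : Fin N → ℝ} (hp : p ∈ feasible c)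
    (hgap : F lam + G W c lam - mutualInfo p W ≤ ε) : IsEpsSolution W c ε lam p := by
  have hweak : ∀ p' ∈ feasible c, ∀ lam', mutualInfo p' W ≤ F lam' + G W c lam' :=
    fun p' hp' lam' => mutualInfo_le_dual hW hpos hγ hp' lam'
  have hlub := fun s S (hr : Reformulates W c s S) => isLUB_capacity hN hW hpos hγ ⟨p, hp⟩ hr
  have hlow := fun s S hr => (hlub s S hr).1 (Set.mem_image_of_mem _ hp)
  have hupp := fun s S hr => (hlub s S hr).2
    (Set.forall_mem_image.2 fun p' hp' => hweak p' hp' lam)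
  refine ⟨hp, hgap, fun lam' => ?_, fun p' hp' => ?_, fun s S hr => ⟨hlow s S hr, ?_⟩,
    fun s S hr => ⟨hupp s S hr, ?_⟩⟩
  · linarith [hweak p hp lam']
  · linarith [hweak p' hp' lam]
  · linarith [hupp s S hr]
  · have : mutualInfo p W ≤ capacity W s S := hlow s S hr
    linarith

/-- Rounding the iteration bound down suffices because the error is governed by $n+1$. -/
theorem isEpsSolution_of_floor_le (hN : 2 ≤ N) (hW : IsChannel W) (hpos : 0 < γ)
    (hγ : ∀ i j, γ ≤ W i j) {c : Option ((Fin N → ℝ) × ℝ)} (hc : (feasible c).Nonempty) {ε : ℝ}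
    (hε : 0 < ε) {n : ℕ} (hn : ⌊iterationBound N M γ ε⌋₊ ≤ n)
    {x₀ : EuclideanSpace ℝ (Fin M)} (hx₀ : x₀ ∈ Q M γ) :
    IsEpsSolution W c ε (lamHat W c γ x₀ n) (pHat W c γ x₀ n) := by
  refine isEpsSolution_of_gap_le (by omega) hW hpos hγ (pHat_mem_feasible W hc γ x₀ n)
    ((gap_le hN hW hpos hγ hc n hx₀).trans (error_le_of_iterationBound_le hN hε ?_))
  have h1 := (Nat.lt_floor_add_one (iterationBound N M γ ε)).le
  have h2 : (⌊iterationBound N M γ ε⌋₊ : ℝ) ≤ n := by exact_mod_cast hn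
  linarith

end Capacity

/-! ### Straight-line programs -/

/-- Every straight-line computation that provides the values in `A` can be extended by at most `c`
operations to one that also provides those in `B`. -/
def ComputesFrom {ι : Type} (A B : Set ((ι → ℝ) → ℝ)) (c : ℕ) : Prop :=
  ∀ k S, StraightLine k S → A ⊆ S →
    ∃ k' S', k' ≤ k + c ∧ StraightLine k' S' ∧ S ⊆ S' ∧ B ⊆ S'

namespace ComputesFrom

variable {ι : Type} {A B C : Set ((ι → ℝ) → ℝ)} {c d : ℕ} {f h : (ι → ℝ) → ℝ}

theorem of_subset (hB : B ⊆ A) : ComputesFrom A B 0 := fun k S hS hA =>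
  ⟨k, S, le_rfl, hS, subset_rfl, hB.trans hA⟩

theorem of_mem (hf : f ∈ A) : ComputesFrom A {f} 0 := of_subset (Set.singleton_subset_iff.2 hf)

theorem mono (hAB : ComputesFrom A B c) (hc : c ≤ d) : ComputesFrom A B d := fun k S hS hA =>
  let ⟨k', S', h1, h2⟩ := hAB k S hS hA
  ⟨k', S', by omega, h2⟩

theorem subset_right (hAB : ComputesFrom A B c) (hC : C ⊆ B) : ComputesFrom A C c :=
  fun k S hS hA =>
    let ⟨k', S', h1, h2, h3, h4⟩ := hAB k S hS hA
    ⟨k', S', h1, h2, h3, hC.trans h4⟩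

theorem subset_left (hAB : ComputesFrom A B c) (hC : A ⊆ C) : ComputesFrom C B c :=
  fun k S hS hA => hAB k S hS (hC.trans hA)

/-- Sharing of intermediate results: $B$ is paid for once and may then be used any number of times.
-/
theorem bind (hAB : ComputesFrom A B c)
    (hBC : ∀ A', A ⊆ A' → B ⊆ A' → ComputesFrom A' C d) : ComputesFrom A C (c + d) := by
  intro k S hS hA
  obtain ⟨k₁, S₁, h1, h2, h3, h4⟩ := hAB k S hS hA
  obtain ⟨k₂, S₂, h5, h6, h7, h8⟩ := hBC S₁ (hA.trans h3) h4 k₁ S₁ h2 subset_rfl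
  exact ⟨k₂, S₂, by omega, h6, h3.trans h7, h8⟩

theorem union (hB : ComputesFrom A B c) (hC : ComputesFrom A C d) :
    ComputesFrom A (B ∪ C) (c + d) := by
  intro k S hS hA
  obtain ⟨k₁, S₁, h1, h2, h3, h4⟩ := hB k S hS hA
  obtain ⟨k₂, S₂, h5, h6, h7, h8⟩ := hC k₁ S₁ h2 (hA.trans h3)
  exact ⟨k₂, S₂, by omega, h6, h3.trans h7, Set.union_subset (h4.trans h7) h8⟩

theorem const (a : ℕ) : ComputesFrom A {fun _ => (a : ℝ)} 1 := fun k S hS _ =>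
  ⟨k + 1, _, le_rfl, hS.const a, Set.subset_insert _ _, by simp⟩

theorem unary {g : (ι → ℝ) → ℝ} (hf : ComputesFrom A {f} c)
    (step : ∀ k S, StraightLine k S → f ∈ S → StraightLine (k + 1) (insert g S)) :
    ComputesFrom A {g} (c + 1) :=
  hf.bind fun A' _ hB k S hS hA' => ⟨k + 1, _, le_rfl,
    step k S hS (hA' (hB rfl)), Set.subset_insert _ _, by simp⟩

theorem binary {g : (ι → ℝ) → ℝ} (hf : ComputesFrom A {f} c) (hh : ComputesFrom A {h} d)
    (step : ∀ k S, StraightLine k S → f ∈ S → h ∈ S → StraightLine (k + 1) (insert g S)) :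
    ComputesFrom A {g} (c + d + 1) :=
  (hf.union hh).bind fun A' _ hB k S hS hA' => ⟨k + 1, _, le_rfl,
    step k S hS (hA' (hB (Or.inl rfl))) (hA' (hB (Or.inr rfl))), Set.subset_insert _ _, by simp⟩

theorem add (hf : ComputesFrom A {f} c) (hh : ComputesFrom A {h} d) :
    ComputesFrom A {fun v => f v + h v} (c + d + 1) := hf.binary hh fun _ _ => .add

theorem sub (hf : ComputesFrom A {f} c) (hh : ComputesFrom A {h} d) :
    ComputesFrom A {fun v => f v - h v} (c + d + 1) := hf.binary hh fun _ _ => .sub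

theorem mul (hf : ComputesFrom A {f} c) (hh : ComputesFrom A {h} d) :
    ComputesFrom A {fun v => f v * h v} (c + d + 1) := hf.binary hh fun _ _ => .mul

theorem div (hf : ComputesFrom A {f} c) (hh : ComputesFrom A {h} d) :
    ComputesFrom A {fun v => f v / h v} (c + d + 1) := hf.binary hh fun _ _ => .div

theorem max (hf : ComputesFrom A {f} c) (hh : ComputesFrom A {h} d) :
    ComputesFrom A {fun v => Max.max (f v) (h v)} (c + d + 1) := hf.binary hh fun _ _ => .max

theorem sqrt (hf : ComputesFrom A {f} c) : ComputesFrom A {fun v => √(f v)} (c + 1) :=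
  hf.unary fun _ _ => .sqrt

theorem exp (hf : ComputesFrom A {f} c) : ComputesFrom A {fun v => Real.exp (f v)} (c + 1) :=
  hf.unary fun _ _ => .exp

theorem log (hf : ComputesFrom A {f} c) : ComputesFrom A {fun v => Real.log (f v)} (c + 1) :=
  hf.unary fun _ _ => .log

theorem congr {g : (ι → ℝ) → ℝ} (hf : ComputesFrom A {f} c) (hfg : ∀ v, f v = g v) :
    ComputesFrom A {g} c := by
  rwa [← funext hfg]

theorem neg (hf : ComputesFrom A {f} c) : ComputesFrom A {fun v => -f v} (c + 2) :=
  (((const 0).sub hf).mono (by omega)).congr fun v => by simp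

theorem inv (hf : ComputesFrom A {f} c) : ComputesFrom A {fun v => (f v)⁻¹} (c + 2) :=
  (((const 1).div hf).mono (by omega)).congr fun v => by simp

theorem range {n : ℕ} {F : Fin n → (ι → ℝ) → ℝ} (hF : ∀ i, ComputesFrom A {F i} c) :
    ComputesFrom A (Set.range F) (n * c) := by
  induction n with
  | zero => exact (of_subset (by simp)).mono (Nat.zero_le _)
  | succ n ih =>
    refine (((ih fun i => hF i.castSucc).union (hF (Fin.last n))).mono
      (by rw [Nat.succ_mul])).subset_right ?_
    rintro _ ⟨i, rfl⟩
    refine Fin.lastCases ?_ (fun i => ?_) i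
    · exact Or.inr rfl
    · exact Or.inl ⟨i, rfl⟩

theorem sum {n : ℕ} {F : Fin n → (ι → ℝ) → ℝ} (hF : ∀ i, ComputesFrom A {F i} c) :
    ComputesFrom A {fun v => ∑ i, F i v} (n * (c + 1) + 1) := by
  induction n with
  | zero => exact ((const 0).mono (by omega)).congr fun v => by simp
  | succ n ih =>
    refine (((ih fun i => hF i.castSucc).add (hF (Fin.last n))).mono ?_).congr fun v =>
      (Fin.sum_univ_castSucc fun i => F i v).symm
    rw [Nat.succ_mul]
    omega

theorem gibbs {n : ℕ} {t : (ι → ℝ) → Fin n → ℝ} (ht : ∀ i, (fun v => t v i) ∈ A) :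
    ComputesFrom A (Set.range fun i v => DMC.gibbs (t v) i) (3 * n + 1) := by
  refine ((range fun i => (of_mem (ht i)).exp).bind (d := 2 * n + 1) fun A₁ _ h₁ =>
    ((sum fun i => of_mem (h₁ ⟨i, rfl⟩)).bind (d := n) fun A₂ h₂ h₃ => ?_).mono
      (by omega)).mono (by omega)
  exact (range fun i => (of_mem (h₂ (h₁ ⟨i, rfl⟩))).div (of_mem (h₃ rfl))).mono (by omega)

end ComputesFrom

/-- A branch-free form, since straight-line programs have `max` but no case distinction. -/
theorem proj_eq_max_smul {R : ℝ} (hR : 0 < R) (x : EuclideanSpace ℝ (Fin M)) :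
    proj R x = (R / max R ‖x‖) • x := by
  unfold proj
  split_ifs with h
  · rw [max_eq_right h.le]
  · rw [max_eq_left (not_lt.1 h), div_self hR.ne', one_smul]

theorem ComputesFrom.proj {ι : Type} {A : Set ((ι → ℝ) → ℝ)} {R : (ι → ℝ) → ℝ}
    (hR : R ∈ A) (hpos : ∀ v, 0 < R v) {w : (ι → ℝ) → EuclideanSpace ℝ (Fin M)}
    (hw : ∀ j, (fun v => w v j) ∈ A) :
    ComputesFrom A (Set.range fun j v => DMC.proj (R v) (w v) j) (3 * M + 4) := by
  have h1 : ComputesFrom A {fun v => R v / Max.max (R v) ‖w v‖} (2 * M + 4) :=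
    (((of_mem hR).div ((of_mem hR).max (sum fun j => (of_mem (hw j)).mul
      (of_mem (hw j))).sqrt)).mono (by omega)).congr fun v => by
        rw [EuclideanSpace.norm_eq]
        simp only [Real.norm_eq_abs, sq_abs]
        simp only [sq]
  refine (h1.bind (d := M) fun A' hA hB =>
    (range fun j => ?_ : ComputesFrom A' _ (M * 1)).mono (by omega)).mono (by omega)
  exact ((of_mem (hB rfl)).mul (of_mem (hA (hw j)))).congr fun v => by
    rw [proj_eq_max_smul (hpos v)]; rfl

/-! ### The algorithm as a straight-line program -/

/-- The smoothed maximizer without cost constraint, in closed form. -/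
noncomputable def inputGibbs (W : Matrix (Fin N) (Fin M) ℝ) (ν : ℝ)
    (x : EuclideanSpace ℝ (Fin M)) : Fin N → ℝ :=
  gibbs fun i => (∑ j, W i j * x j + -condEntropy W i) * Real.log 2 / ν

/-- The gradient of the smoothed dual function without cost constraint, in closed form. -/
noncomputable def gibbsGradient (W : Matrix (Fin N) (Fin M) ℝ) (ν : ℝ)
    (x : EuclideanSpace ℝ (Fin M)) : EuclideanSpace ℝ (Fin M) :=
  WithLp.toLp 2 fun j => output W (inputGibbs W ν x) j - outputMaximizer x j

theorem smoothGradient_none (hN : 0 < N) {W : Matrix (Fin N) (Fin M) ℝ} (hW : IsChannel W)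
    {ν : ℝ} (hν : 0 < ν) : smoothGradient W none ν = gibbsGradient W ν := by
  funext x
  ext j
  rw [smoothGradient_apply (hW.output_pos hN) hW ⟨_, gibbs_mem hN 0⟩ hν,
    smoothMaximizer_none hN W hν]
  rfl

/-- Raw input data: entries of the channel matrix, coordinates of the starting point, and `γ`. -/
abbrev Data (N M : ℕ) : Type := (Fin N × Fin M) ⊕ Fin M ⊕ Unit → ℝ

def Data.channel (v : Data N M) : Matrix (Fin N) (Fin M) ℝ :=
  Matrix.of fun i j => v (Sum.inl (i, j))

noncomputable def Data.start (v : Data N M) : EuclideanSpace ℝ (Fin M) :=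
  WithLp.toLp 2 fun j => v (Sum.inr (Sum.inl j))

def Data.floor (v : Data N M) : ℝ := v (Sum.inr (Sum.inr ()))

/-- The smoothing parameter computed from the raw data. -/
noncomputable def Data.smoothing (v : Data N M) (n : ℕ) : ℝ := DMC.smoothing N M v.floor n

/-- The state of the scheme with closed-form gradients on raw data. -/
noncomputable def Data.state (v : Data N M) (n k : ℕ) :
    EuclideanSpace ℝ (Fin M) × EuclideanSpace ℝ (Fin M) :=
  schemeState (gibbsGradient v.channel (v.smoothing n)) (1 + 1 / v.smoothing n)
    (radius M v.floor) v.start k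

noncomputable def Data.gradientStep (v : Data N M) (n k : ℕ) : EuclideanSpace ℝ (Fin M) :=
  schemeY (gibbsGradient v.channel (v.smoothing n)) (1 + 1 / v.smoothing n)
    (radius M v.floor) v.start k

/-- The partial sums of the averaged primal iterates. -/
noncomputable def Data.average (v : Data N M) (n k : ℕ) : Fin N → ℝ :=
  ∑ i ∈ Finset.range k, (2 * ((i : ℝ) + 1) / (((n : ℝ) + 1) * ((n : ℝ) + 2))) •
    inputGibbs v.channel (v.smoothing n) (v.state n i).1

/-- Quantities that are computed once, before the iteration. -/
def Data.constants (N M n : ℕ) : Set (Data N M → ℝ) :=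
  (Set.range fun (ij : Fin N × Fin M) (v : Data N M) => v.channel ij.1 ij.2) ∪
    (Set.range fun (i : Fin N) (v : Data N M) => condEntropy v.channel i) ∪
    {fun _ => Real.log 2} ∪ {fun v => v.smoothing n} ∪ {fun v => radius M v.floor}

/-- The values carried from one iteration to the next. -/
def Data.iterates (N M n k : ℕ) : Set (Data N M → ℝ) :=
  (Set.range fun (j : Fin M) (v : Data N M) => (v.state n k).1 j) ∪
    (Set.range fun (j : Fin M) (v : Data N M) => (v.state n k).2 j) ∪
    (Set.range fun (i : Fin N) (v : Data N M) => v.average n k i)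

section Step

variable {A : Set (Data N M → ℝ)} {n : ℕ}

theorem computesFrom_inputGibbs (hA : Data.constants N M n ⊆ A)
    {x : Data N M → EuclideanSpace ℝ (Fin M)} (hx : ∀ j, (fun v => x v j) ∈ A) :
    ComputesFrom A (Set.range fun (i : Fin N) (v : Data N M) => inputGibbs v.channel (v.smoothing n) (x v) i)
      (N * (2 * M + 6) + (3 * N + 1)) := by
  have hW : ∀ i j, (fun v : Data N M => v.channel i j) ∈ A := fun i j =>
    hA (Or.inl (Or.inl (Or.inl (Or.inl ⟨(i, j), rfl⟩))))
  have hr : ∀ i, (fun v : Data N M => condEntropy v.channel i) ∈ A := fun i =>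
    hA (Or.inl (Or.inl (Or.inl (Or.inr ⟨i, rfl⟩))))
  have hlog : (fun _ : Data N M => Real.log 2) ∈ A := hA (Or.inl (Or.inl (Or.inr rfl)))
  have hν : (fun v : Data N M => v.smoothing n) ∈ A := hA (Or.inl (Or.inr rfl))
  refine ComputesFrom.bind (B := Set.range fun (i : Fin N) (v : Data N M) =>
    (∑ j, v.channel i j * x v j + -condEntropy v.channel i) * Real.log 2 / v.smoothing n)
    (ComputesFrom.range fun i => ?_) fun A' _ hB => ?_
  · exact (((((ComputesFrom.sum fun j => (ComputesFrom.of_mem (hW i j)).mul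
      (.of_mem (hx j))).add (ComputesFrom.of_mem (hr i)).neg).mul (.of_mem hlog)).div
        (.of_mem hν))).mono (by omega)
  · exact ComputesFrom.gibbs fun i => hB ⟨i, rfl⟩

theorem computesFrom_gibbsGradient (hA : Data.constants N M n ⊆ A)
    {x : Data N M → EuclideanSpace ℝ (Fin M)} (hx : ∀ j, (fun v => x v j) ∈ A)
    (hp : ∀ i, (fun v : Data N M => inputGibbs v.channel (v.smoothing n) (x v) i) ∈ A) :
    ComputesFrom A (Set.range fun (j : Fin M) (v : Data N M) =>
      gibbsGradient v.channel (v.smoothing n) (x v) j)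
      (M * 3 + ((3 * M + 1) + M * (2 * N + 2))) := by
  have hW : ∀ i j, (fun v : Data N M => v.channel i j) ∈ A := fun i j =>
    hA (Or.inl (Or.inl (Or.inl (Or.inl ⟨(i, j), rfl⟩))))
  have hlog : (fun _ : Data N M => Real.log 2) ∈ A := hA (Or.inl (Or.inl (Or.inr rfl)))
  refine ComputesFrom.bind (B := Set.range fun (j : Fin M) (v : Data N M) =>
    -x v j * Real.log 2) (ComputesFrom.range fun j =>
      (ComputesFrom.of_mem (hx j)).neg.mul (.of_mem hlog)) fun A₁ h₁ hB => ?_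
  refine (ComputesFrom.gibbs fun j => hB ⟨j, rfl⟩).bind fun A₂ h₂ hq => ?_
  refine ComputesFrom.range fun j => ?_
  exact ((ComputesFrom.sum fun i => (ComputesFrom.of_mem (h₂ (h₁ (hW i j)))).mul
    (.of_mem (h₂ (h₁ (hp i))))).sub (.of_mem (hq ⟨j, rfl⟩))).mono (by omega)

theorem computesFrom_step (hM : 0 < M) (hN : 0 < N) (k : ℕ) (hA : Data.constants N M n ⊆ A)
    (hk : Data.iterates N M n k ⊆ A) :
    ComputesFrom A (Data.iterates N M n (k + 1) ∪
      Set.range fun (j : Fin M) (v : Data N M) => v.gradientStep n k j) (100 * (M * N)) := by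
  have hx : ∀ j, (fun v : Data N M => (v.state n k).1 j) ∈ A := fun j =>
    hk (Or.inl (Or.inl ⟨j, rfl⟩))
  have ha : ∀ j, (fun v : Data N M => (v.state n k).2 j) ∈ A := fun j =>
    hk (Or.inl (Or.inr ⟨j, rfl⟩))
  have hs : ∀ i, (fun v : Data N M => v.average n k i) ∈ A := fun i => hk (Or.inr ⟨i, rfl⟩)
  have hν : (fun v : Data N M => v.smoothing n) ∈ A := hA (Or.inl (Or.inr rfl))
  have hR : (fun v : Data N M => radius M v.floor) ∈ A := hA (Or.inr rfl)
  -- The summands follow the nesting of the stages below; all are absorbed through $M\le MN$ and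
  -- $N\le MN$.
  have hcount : N * (2 * M + 6) + (3 * N + 1) + ((M * 3 + ((3 * M + 1) + M * (2 * N + 2))) +
      (M * 5 + (M * 9 + ((3 * M + 4) + (M * 10 + ((3 * M + 4) +
        (M * 9 + N * 9))))))) ≤ 100 * (M * N) := by
    have h1 : M ≤ M * N := Nat.le_mul_of_pos_right M hN
    have h2 : N ≤ M * N := Nat.le_mul_of_pos_left N hM
    nlinarith
  refine ComputesFrom.mono ?_ hcount
  refine (computesFrom_inputGibbs hA hx).bind fun A₁ h₁ hp => ?_
  refine (computesFrom_gibbsGradient (hA.trans h₁) (fun j => h₁ (hx j))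
    fun i => hp ⟨i, rfl⟩).bind fun A₂ h₂ hg => ?_
  refine ComputesFrom.bind (B := Set.range fun (j : Fin M) (v : Data N M) =>
    (v.state n (k + 1)).2 j) (ComputesFrom.range fun j => ?_) fun A₃ h₃ ha' => ?_
  · exact (((ComputesFrom.of_mem (h₂ (h₁ (ha j)))).add
      (((ComputesFrom.const (k + 1)).div (.const 2)).mul (.of_mem (hg ⟨j, rfl⟩)))).mono
        (by omega)).congr fun v => by push_cast; rfl
  refine ComputesFrom.bind (B := Set.range fun (j : Fin M) (v : Data N M) =>
    (-((1 / (1 + 1 / v.smoothing n)) • (v.state n (k + 1)).2)) j)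
    (ComputesFrom.range fun j => ?_) fun A₄ h₄ hw => ?_
  · exact ((((ComputesFrom.const 1).div ((ComputesFrom.const 1).add ((ComputesFrom.const 1).div
      (.of_mem (h₃ (h₂ (h₁ hν))))))).mul (.of_mem (ha' ⟨j, rfl⟩))).neg.mono
        (by omega)).congr fun v => by simp
  -- The radius is positive for arbitrary raw data, thanks to the term $1/\ln2$ in its maximum.
  refine (ComputesFrom.proj (h₄ (h₃ (h₂ (h₁ hR)))) (fun v => radius_pos hM _)
    fun j => hw ⟨j, rfl⟩).bind fun A₅ h₅ hz => ?_
  refine ComputesFrom.bind (B := Set.range fun (j : Fin M) (v : Data N M) =>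
    (-((1 / (1 + 1 / v.smoothing n)) • gibbsGradient v.channel (v.smoothing n) (v.state n k).1) +
      (v.state n k).1) j)
    (ComputesFrom.range fun j => ?_) fun A₆ h₆ hw' => ?_
  · exact (((((ComputesFrom.const 1).div ((ComputesFrom.const 1).add ((ComputesFrom.const 1).div
      (.of_mem (h₅ (h₄ (h₃ (h₂ (h₁ hν))))))))).mul
        (.of_mem (h₅ (h₄ (h₃ (hg ⟨j, rfl⟩)))))).neg.add
          (.of_mem (h₅ (h₄ (h₃ (h₂ (h₁ (hx j)))))))).mono (by omega)).congr fun v => by simp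
  refine (ComputesFrom.proj (h₆ (h₅ (h₄ (h₃ (h₂ (h₁ hR)))))) (fun v => radius_pos hM _)
    fun j => hw' ⟨j, rfl⟩).bind fun A₇ h₇ hy => ?_
  refine ComputesFrom.bind (B := Set.range fun (j : Fin M) (v : Data N M) =>
    (v.state n (k + 1)).1 j) (ComputesFrom.range fun j => ?_) fun A₈ h₈ hx' => ?_
  · exact (((((ComputesFrom.const 2).div (.const (k + 3))).mul
      (.of_mem (h₇ (h₆ (hz ⟨j, rfl⟩))))).add
        (((ComputesFrom.const (k + 1)).div (.const (k + 3))).mul (.of_mem (hy ⟨j, rfl⟩)))).mono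
          (by omega)).congr fun v => by push_cast; rfl
  have hs' : ComputesFrom A₈ (Set.range fun (i : Fin N) (v : Data N M) => v.average n (k + 1) i)
      (N * 9) := by
    refine ComputesFrom.range fun i => ?_
    have hold := h₈ (h₇ (h₆ (h₅ (h₄ (h₃ (h₂ (h₁ (hs i))))))))
    have hnew := h₈ (h₇ (h₆ (h₅ (h₄ (h₃ (h₂ (hp ⟨i, rfl⟩)))))))
    exact (((ComputesFrom.of_mem hold).add ((((ComputesFrom.const 2).mul (.const (k + 1))).div
      ((ComputesFrom.const (n + 1)).mul (.const (n + 2)))).mul (.of_mem hnew))).mono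
            (by omega)).congr fun v => by
              simp only [Data.average, Finset.sum_range_succ, Pi.add_apply, Pi.smul_apply,
                smul_eq_mul]
              push_cast
              rfl
  refine ((ComputesFrom.of_subset (B := (Set.range fun (j : Fin M) (v : Data N M) =>
    (v.state n (k + 1)).1 j) ∪ (Set.range fun (j : Fin M) (v : Data N M) =>
      (v.state n (k + 1)).2 j) ∪ (Set.range fun (j : Fin M) (v : Data N M) =>
        v.gradientStep n k j)) ?_).union hs').mono (by omega) |>.subset_right ?_
  · refine Set.union_subset (Set.union_subset hx' ?_) (hy.trans h₈)
    exact ha'.trans (h₄.trans (h₅.trans (h₆.trans (h₇.trans h₈))))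
  · rintro f (((h | h) | h) | h)
    · exact Or.inl (Or.inl (Or.inl h))
    · exact Or.inl (Or.inl (Or.inr h))
    · exact Or.inr h
    · exact Or.inl (Or.inr h)

end Step

theorem computesFrom_constants (hM : 0 < M) (hN : 0 < N) (n : ℕ) :
    ComputesFrom (Set.range fun (i : (Fin N × Fin M) ⊕ Fin M ⊕ Unit) (v : Data N M) => v i)
      (Data.constants N M n) (100 * (M * N)) := by
  have hcount : 2 + (N * (4 * M + 3) + 41) ≤ 100 * (M * N) := by
    have h1 : M ≤ M * N := Nat.le_mul_of_pos_right M hN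
    have h2 : N ≤ M * N := Nat.le_mul_of_pos_left N hM
    nlinarith
  refine ComputesFrom.mono ?_ hcount
  refine ComputesFrom.bind (B := {fun _ => Real.log 2}) ((ComputesFrom.const 2).log.congr
    fun v => by simp) fun A₁ h₁ hlog => ?_
  have hlog' : ComputesFrom A₁ {fun _ : Data N M => Real.log 2} 0 := .of_mem (hlog rfl)
  have hW : ∀ i j, ComputesFrom A₁ {fun v : Data N M => v.channel i j} 0 := fun i j =>
    .of_mem (h₁ ⟨Sum.inl (i, j), rfl⟩)
  have hγ : ComputesFrom A₁ {fun v : Data N M => v.floor} 0 :=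
    .of_mem (h₁ ⟨Sum.inr (Sum.inr ()), rfl⟩)
  have hinv : ComputesFrom A₁ {fun v : Data N M => Real.logb 2 v.floor⁻¹} 4 :=
    (hγ.inv.log.div hlog').congr fun v => rfl
  have hone : ComputesFrom A₁ {fun _ : Data N M => 1 / Real.log 2} 2 :=
    ((ComputesFrom.const 1).div hlog').congr fun v => by simp
  have hr : ComputesFrom A₁ (Set.range fun (i : Fin N) (v : Data N M) =>
      condEntropy v.channel i) (N * (4 * M + 3)) :=
    ComputesFrom.range fun i => ((ComputesFrom.sum fun j => (hW i j).mul
      ((hW i j).log.div hlog')).neg.mono (by omega)).congr fun v => rfl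
  have hR : ComputesFrom A₁ {fun v : Data N M => radius M v.floor} 9 :=
    ((ComputesFrom.const M).mul (hinv.max hone)).congr fun v => rfl
  have hmax := ((ComputesFrom.const M).mul hinv).max hone
  have hν : ComputesFrom A₁ {fun v : Data N M => v.smoothing n} 32 :=
    ((((ComputesFrom.const 2).div (.const (n + 1))).mul
      (((((ComputesFrom.const 1).div (.const 2)).mul (hmax.mul hmax)).div
        ((ComputesFrom.const N).log.div hlog')).sqrt)).mono (by omega)).congr fun v => by
          simp only [Data.smoothing, smoothing, D₁, D₂, Real.logb, sq]
          push_cast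
          rfl
  have hWall : ComputesFrom A₁ ((Set.range fun (ij : Fin N × Fin M) (v : Data N M) =>
      v.channel ij.1 ij.2)) 0 :=
    .of_subset (by rintro _ ⟨ij, rfl⟩; exact h₁ ⟨Sum.inl ij, rfl⟩)
  exact ((((hWall.union hr).union hlog').union hν).union hR).mono (by omega)

theorem computesFrom_iterates (hM : 0 < M) (hN : 0 < N) (n k : ℕ) :
    ComputesFrom ((Set.range fun (i : (Fin N × Fin M) ⊕ Fin M ⊕ Unit) (v : Data N M) => v i) ∪
      Data.constants N M n) (Data.iterates N M n k) (100 * (M * N) * k + 1) := by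
  induction k with
  | zero =>
    refine ((ComputesFrom.const 0).bind (d := 0) fun A' hA h0 => .of_subset ?_).mono (by omega)
    have h0 : (fun _ : Data N M => (0 : ℝ)) ∈ A' := h0 (by simp)
    rintro f ((⟨j, rfl⟩ | ⟨j, rfl⟩) | ⟨i, rfl⟩)
    · exact hA (Or.inl ⟨Sum.inr (Sum.inl j), rfl⟩)
    · exact h0
    · convert h0 using 2
      simp [Data.average]
  | succ k ih =>
    refine (ih.bind fun A' hA hk => (computesFrom_step hM hN k (Set.subset_union_right.trans hA)
      hk).subset_right Set.subset_union_left).mono ?_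
    rw [Nat.mul_succ]
    omega

/-- The setup, $n$ iterations and one further step cost at most $100MN$ each, up to one constant;
the further step supplies $y_n$ and the last term of $\hat p$. The program computes the closed forms
on all raw data, and the channel property serves only to identify them with the algorithm. -/
theorem runsInOps (hM : 0 < M) (hN : 2 ≤ N) (n : ℕ) :
    ∃ k : ℕ, k ≤ 300 * (M * N * (n + 1)) ∧ RunsInOps N M n k := by
  have hN0 : 0 < N := by omega
  have hcomp : ComputesFrom
      (Set.range fun (i : (Fin N × Fin M) ⊕ Fin M ⊕ Unit) (v : Data N M) => v i)
      (Data.iterates N M n (n + 1) ∪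
        Set.range fun (j : Fin M) (v : Data N M) => v.gradientStep n n j)
      (300 * (M * N * (n + 1))) := by
    refine ((computesFrom_constants hM hN0 n).bind fun A₁ h₁ hc =>
      ((computesFrom_iterates hM hN0 n n).subset_left (Set.union_subset h₁ hc)).bind
        fun A₂ h₂ hit => computesFrom_step hM hN0 n (hc.trans h₂) hit).mono ?_
    have : 0 < M * N := Nat.mul_pos hM hN0
    nlinarith
  obtain ⟨k, S, hk, hS, -, hsub⟩ := hcomp 0 _ .inputs subset_rfl
  refine ⟨k, by omega, S, hS, fun j v => Data.gradientStep v n n j,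
    fun i v => Data.average v n (n + 1) i, fun j => hsub (Or.inr ⟨j, rfl⟩),
    fun i => hsub (Or.inl (Or.inr ⟨i, rfl⟩)), ?_⟩
  intro W γ x₀ hW _ _ _
  have hν := smoothing_pos hN M γ n
  have hg := smoothGradient_none hN0 hW hν
  refine ⟨fun j => ?_, fun i => ?_⟩
  · rw [lamHat, hg]
    rfl
  · simp only [pHat, queryPoint, hg, smoothMaximizer_none hN0 W hν]
    rfl

/-! ### The number of operations for accuracy `ε` -/

/-- $\sqrt{D_1D_2}/\varepsilon$, $\sqrt{D_1/\varepsilon}$ and $1$ are each at most $R\sqrt{\log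
N}/\varepsilon$, and $4+2+1=7$; the last two use $\varepsilon\le1$. -/
theorem iterationBound_add_one_le (hM : 0 < M) (hN : 2 ≤ N) {γ ε : ℝ} (hε : 0 < ε)
    (hε1 : ε ≤ 1) : iterationBound N M γ ε + 1 ≤
      7 * (M * max (Real.logb 2 γ⁻¹) (1 / Real.log 2) * √(Real.logb 2 N) / ε) := by
  have hM1 : (1 : ℝ) ≤ M := by exact_mod_cast hM
  have hlog : 1 ≤ 1 / Real.log 2 := by
    rw [le_div_iff₀ (Real.log_pos one_lt_two)]; linarith [Real.log_two_lt_d9]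
  set R := (M : ℝ) * max (Real.logb 2 γ⁻¹) (1 / Real.log 2) with hR
  have hR1 : 1 ≤ R := by
    have : 1 ≤ max (Real.logb 2 γ⁻¹) (1 / Real.log 2) := le_max_of_le_right hlog
    nlinarith
  set E := √(Real.logb 2 N)
  have hE : 1 ≤ E := Real.one_le_sqrt.2 (one_le_D₂ hN)
  have hD : √(D₁ M γ) ≤ R := by
    refine Real.sqrt_le_iff.2 ⟨by linarith, ?_⟩
    have h1 : max (M * Real.logb 2 γ⁻¹) (1 / Real.log 2) ≤ R := by
      refine max_le (mul_le_mul_of_nonneg_left (le_max_left _ _) (by linarith)) ?_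
      have : 1 / Real.log 2 ≤ max (Real.logb 2 γ⁻¹) (1 / Real.log 2) := le_max_right _ _
      nlinarith
    have h2 : 0 ≤ max (M * Real.logb 2 γ⁻¹) (1 / Real.log 2) := le_max_of_le_right (by linarith)
    have h3 := pow_le_pow_left₀ h2 h1 2
    rw [D₁]
    nlinarith
  have hinv : 1 ≤ 1 / ε := (one_le_div hε).2 hε1
  have h1 : √(D₁ M γ * D₂ N) * (1 / ε) ≤ R * E / ε := by
    rw [Real.sqrt_mul (D₁_pos M γ).le, mul_one_div]
    change √(D₁ M γ) * E / ε ≤ _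
    gcongr
  have h2 : √(D₁ M γ / ε) ≤ R * E / ε := by
    refine Real.sqrt_le_iff.2 ⟨by positivity, ?_⟩
    have h3 : D₁ M γ ≤ R ^ 2 := (Real.sqrt_le_left (by linarith)).1 hD
    calc D₁ M γ / ε ≤ R ^ 2 / ε := by gcongr
      _ ≤ (R * E) ^ 2 / ε ^ 2 := by
        gcongr
        · exact le_mul_of_one_le_right (by linarith) hE
        · nlinarith
      _ = (R * E / ε) ^ 2 := by rw [div_pow]
  have h3 : 1 ≤ R * E / ε := by
    rw [le_div_iff₀ hε]
    nlinarith
  rw [iterationBound]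
  linarith

end DMC

/-! ### Assembly of the three claims -/

theorem mainTheorem9 :
    (∀ (N M : ℕ) (W : Matrix (Fin N) (Fin M) ℝ) (γ : ℝ) (c : Option ((Fin N → ℝ) × ℝ)),
      2 ≤ N → DMC.IsChannel W → 0 < γ → (∀ i j, γ ≤ W i j) → (DMC.feasible c).Nonempty →
      (∀ (n : ℕ), ∀ x₀ ∈ DMC.Q M γ,
        DMC.lamHat W c γ x₀ n ∈ DMC.Q M γ ∧
        DMC.pHat W c γ x₀ n ∈ stdSimplex ℝ (Fin N) ∧
        DMC.pHat W c γ x₀ n ∈ DMC.feasible c ∧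
        0 ≤ DMC.F (DMC.lamHat W c γ x₀ n) + DMC.G W c (DMC.lamHat W c γ x₀ n)
            - DMC.mutualInfo (DMC.pHat W c γ x₀ n) W ∧
        DMC.F (DMC.lamHat W c γ x₀ n) + DMC.G W c (DMC.lamHat W c γ x₀ n)
            - DMC.mutualInfo (DMC.pHat W c γ x₀ n) W
          ≤ 4 / ((n : ℝ) + 1) * √(DMC.D₁ M γ * DMC.D₂ N) + 4 * DMC.D₁ M γ / ((n : ℝ) + 1) ^ 2) ∧
      (∀ ε : ℝ, 0 < ε → ∃ n₀ : ℕ, (n₀ : ℝ) ≤ DMC.iterationBound N M γ ε ∧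
        ∀ n ≥ n₀, ∀ x₀ ∈ DMC.Q M γ,
          DMC.IsEpsSolution W c ε (DMC.lamHat W c γ x₀ n) (DMC.pHat W c γ x₀ n))) ∧
    (∃ C : ℝ, 0 < C ∧ ∀ N M : ℕ, 2 ≤ N → 1 ≤ M →
      (∀ n : ℕ, ∃ k : ℕ, (k : ℝ) ≤ C * (M * N * ((n : ℝ) + 1)) ∧ DMC.RunsInOps N M n k) ∧
      (∀ γ ε : ℝ, 0 < γ → 0 < ε → ε ≤ 1 →
        ∃ n k : ℕ, (n : ℝ) ≤ DMC.iterationBound N M γ ε ∧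
          (k : ℝ) ≤ C * max (Real.logb 2 γ⁻¹) (1 / Real.log 2)
            * ((M : ℝ) ^ 2 * N * √(Real.logb 2 N) / ε) ∧
          DMC.RunsInOps N M n k ∧
          ∀ (W : Matrix (Fin N) (Fin M) ℝ), DMC.IsChannel W → (∀ i j, γ ≤ W i j) →
            ∀ x₀ ∈ DMC.Q M γ,
              DMC.IsEpsSolution W none ε (DMC.lamHat W none γ x₀ n) (DMC.pHat W none γ x₀ n))) := by
  have hbound : ∀ N M : ℕ, ∀ γ ε : ℝ, 0 < ε → 0 ≤ DMC.iterationBound N M γ ε := fun N M γ ε hε => by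
    unfold DMC.iterationBound
    positivity
  refine ⟨fun N M W γ c hN hW hpos hγ hc => ⟨fun n x₀ hx₀ => ?_, fun ε hε => ?_⟩,
    -- $2100=300\cdot7$: the cost per iteration times the constant of the iteration bound.
    2100, by norm_num, fun N M hN hM => ⟨fun n => ?_, fun γ ε hpos hε hε1 => ?_⟩⟩
  · have hp := DMC.pHat_mem_feasible W hc γ x₀ n
    exact ⟨DMC.norm_proj_le (DMC.radius_pos (hW.output_pos (by omega)) γ).le _,
      DMC.feasible_subset c hp, hp, sub_nonneg.2 (DMC.mutualInfo_le_dual hW hpos hγ hp _),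
      DMC.gap_le hN hW hpos hγ hc n hx₀⟩
  · exact ⟨⌊DMC.iterationBound N M γ ε⌋₊, Nat.floor_le (hbound N M γ ε hε), fun n hn x₀ hx₀ =>
      DMC.isEpsSolution_of_floor_le hN hW hpos hγ hc hε hn hx₀⟩
  · obtain ⟨k, hk, hrun⟩ := DMC.runsInOps hM hN n
    refine ⟨k, ?_, hrun⟩
    have hk' : (k : ℝ) ≤ 300 * (M * N * ((n : ℝ) + 1)) := by exact_mod_cast hk
    have : (0 : ℝ) ≤ M * N * ((n : ℝ) + 1) := by positivity
    linarith
  · obtain ⟨k, hk, hrun⟩ := DMC.runsInOps hM hN ⌊DMC.iterationBound N M γ ε⌋₊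
    have hfloor := Nat.floor_le (hbound N M γ ε hε)
    refine ⟨_, k, hfloor, ?_, hrun, fun W hW hγ x₀ hx₀ => DMC.isEpsSolution_of_floor_le hN hW hpos
      hγ (c := none) ⟨_, DMC.gibbs_mem (by omega) 0⟩ hε le_rfl hx₀⟩
    have hk' : (k : ℝ) ≤ 300 * (M * N * ((⌊DMC.iterationBound N M γ ε⌋₊ : ℝ) + 1)) := by
      exact_mod_cast hk
    have hit := DMC.iterationBound_add_one_le (γ := γ) hM hN hε hε1
    calc (k : ℝ) ≤ 300 * (M * N * ((⌊DMC.iterationBound N M γ ε⌋₊ : ℝ) + 1)) := hk'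
      _ ≤ 300 * (M * N * (7 * (M * max (Real.logb 2 γ⁻¹) (1 / Real.log 2) *
          √(Real.logb 2 N) / ε))) := by
        have : (⌊DMC.iterationBound N M γ ε⌋₊ : ℝ) + 1 ≤ 7 * (M *
          max (Real.logb 2 γ⁻¹) (1 / Real.log 2) * √(Real.logb 2 N) / ε) := by linarith
        gcongr
      _ = 2100 * max (Real.logb 2 γ⁻¹) (1 / Real.log 2) *
          ((M : ℝ) ^ 2 * N * √(Real.logb 2 N) / ε) := by ring
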